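/- **Theorem 1.3.** Let $X$ be a separable Hilbert space over $\mathbb K=\mathbb R$ or $\mathbb C$ and let $A:D(A)\subset X\to X$ be a densely defined self-adjoint linear operator which is accretive, $\operatorname{Re}\langle Ax,x\rangle\ge 0$ for all $x\in D(A)$, and such that $(\lambda I+A)^{-1}:X\to X$ is compact for some $\lambda>0$. Let $\lambda_1$ be the smallest eigenvalue of $A$ and let $\varphi_1$ be a corresponding eigenvector with $\|\varphi_1\|=1$. Let $B:X\to X$ be a bounded linear operator. For $T>0$, $y_0\in X$ and $p\in L^2(0,T)$ (with values in $\mathbb K$), let $y(\cdot;y_0,p)$ be the mild solution of $y'+Ay+p(t)B\varphi_1=0$ on $[0,T]$, $y(0)=y_0$, i.e. $y(t)=e^{-tA}y_0-\int_0^t e^{-(t-s)A}p(s)B\varphi_1\,ds$. Assume that $\{A,B\}$ is $1$-null controllable in any time $T>0$: for every $T>0$ there is $N_T>0$ such that for every $y_0\in X$ there is $p\in L^2(0,T)$ with $\|p\|_{L^2(0,T)}\le N_T\|y_0\|$ and $y(T;y_0,p)=0$. Assume also that for some constants $\nu,T_0>0$ the control cost $$N(\tau)=\sup_{\|y_0\|=1}\inf\{\|p\|_{L^2(0,\tau)}: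 y(\tau;y_0,p)=0\}$$ satisfies $N(\tau)\le e^{\nu/\tau}$ for all $0<\tau\le T_0$. Then there exists $r_1>0$ such that for every $R>0$ there exists $T_R>0$ such that for every $u_0\in X$ with $$|\langle u_0,\varphi_1\rangle-1|<r_1,\qquad \|u_0-\langle u_0,\varphi_1\rangle\varphi_1\|\le R,$$ there is a control $p\in L^2(0,T_R)$ for which the mild solution $u\in C([0,T_R];X)$ of $$u'(t)+Au(t)+p(t)Bu(t)=0,\qquad u(0)=u_0,$$ that is, $u(t)=e^{-tA}u_0-\int_0^t e^{-(t-s)A}p(s)Bu(s)\,ds$ on $[0,T_R]$, satisfies $u(T_R)=\psi_1(T_R)$, where $\psi_1(t)=e^{-\lambda_1t}\varphi_1$. -/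

import Mathlib

open MeasureTheory Set
open scoped ENNReal

namespace BilinearControl

noncomputable section

variable {𝕜 X : Type*} [RCLike 𝕜] [NormedAddCommGroup X] [InnerProductSpace 𝕜 X]

/-- `B` is the everywhere defined two-sided inverse of `mu I + A`, that is,
`(mu I + A)⁻¹ = B`. -/
def IsShiftedInverse (A : X →ₗ.[𝕜] X) (mu : ℝ) (B : X →L[𝕜] X) : Prop :=
  (∀ x : X, ∃ h : B x ∈ A.domain, (mu : 𝕜) • B x + A ⟨B x, h⟩ = x) ∧
    ∀ x : A.domain, B ((mu : 𝕜) • (x : X) + A x) = x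

/-- Standing assumptions on the (unbounded) operator `A : D(A) ⊆ X → X`: it is densely defined and
self-adjoint, `⟨A x, x⟩ ≥ -σ ‖x‖²` on `D(A)`, and `(mu I + A)⁻¹ : X → X` is compact for some
`mu > -σ`. For `σ = 0` the operator is accretive. -/
structure IsSemiboundedCompactResolvent [CompleteSpace X] (A : X →ₗ.[𝕜] X) (σ : ℝ) : Prop where
  dense_domain : Dense (A.domain : Set X)
  selfAdjoint : IsSelfAdjoint A
  bounded_below : ∀ x : A.domain, -σ * ‖(x : X)‖ ^ 2 ≤ RCLike.re (inner 𝕜 (A x) (x : X))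
  compact_resolvent : ∃ mu : ℝ, -σ < mu ∧ ∃ B : X →L[𝕜] X,
    IsShiftedInverse A mu B ∧ IsCompactOperator B

/-- The eigenspace `{x ∈ D(A) : A x = mu x}`. -/
def eigenspace (A : X →ₗ.[𝕜] X) (mu : ℝ) : Submodule 𝕜 X :=
  (LinearMap.ker (A.toFun - (mu : 𝕜) • A.domain.subtype)).map A.domain.subtype

/-- `lam` is the smallest eigenvalue of `A` and `φ` is a normalized eigenvector for it. (The
eigenvalues of a self-adjoint operator are real.) -/
structure IsFirstEigenpair (A : X →ₗ.[𝕜] X) (lam : ℝ) (φ : X) : Prop where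
  mem : φ ∈ eigenspace A lam
  norm_eq_one : ‖φ‖ = 1
  least : ∀ mu : ℝ, eigenspace A mu ≠ ⊥ → lam ≤ mu

variable [CompleteSpace X]

/-- The semigroup `e^{-tA}`, `t ≥ 0`, generated by `-A`, for a self-adjoint operator `A` bounded from
below with compact resolvent: `e^{-tA} x = ∑_mu e^{-t mu} P_mu x`, where `P_mu` is the orthogonal
projection onto the eigenspace of `mu`. Only eigenvalues `mu` contribute to the sum, and the
eigenspaces are closed, so that passing to the closure changes nothing. -/
def semigroup (A : X →ₗ.[𝕜] X) (t : ℝ) (x : X) : X :=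
  ∑' mu : ℝ, ((Real.exp (-(t * mu)) : ℝ) : 𝕜) •
    (eigenspace A mu).topologicalClosure.starProjection x

/-- `u ∈ C([0,T]; X)` is a mild solution of
`u'(t) + A u(t) + p(t) B u(t) + f(t) = 0` on `[0,T]`, `u(0) = u₀`, that is,
`u(t) = e^{-tA} u₀ - ∫₀ᵗ e^{-(t-s)A} (p(s) B u(s) + f(s)) ds` for all `t ∈ [0,T]`. -/
def IsMildSolution [NormedSpace ℝ X] (A : X →ₗ.[𝕜] X) (B : X →L[𝕜] X) (p : ℝ → 𝕜) (f : ℝ → X)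
    (T : ℝ) (u₀ : X) (u : ℝ → X) : Prop :=
  ContinuousOn u (Icc 0 T) ∧
    ∀ t ∈ Icc 0 T, u t = semigroup A t u₀ -
      ∫ s in (0 : ℝ)..t, semigroup A (t - s) (p s • B (u s) + f s)

/-- `p ∈ L²(0,T)`. -/
def IsControl (p : ℝ → 𝕜) (T : ℝ) : Prop := MemLp p 2 (volume.restrict (Ioo 0 T))

/-- `‖p‖_{L²(0,T)}`. -/
def controlNorm (p : ℝ → 𝕜) (T : ℝ) : ℝ≥0∞ := eLpNorm p 2 (volume.restrict (Ioo 0 T))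

/-- The control `p` steers the linear system `y' + A y + p(t) B φ = 0`, `y(0) = y₀`, to `0` at time
`T`: `p ∈ L²(0,T)` and `y(T; y₀, p) = 0`. -/
def SteersLinearToZero [NormedSpace ℝ X] (A : X →ₗ.[𝕜] X) (B : X →L[𝕜] X) (φ : X) (T : ℝ) (y₀ : X)
    (p : ℝ → 𝕜) : Prop :=
  IsControl p T ∧ ∃ y : ℝ → X, IsMildSolution A 0 p (fun s => p s • B φ) T y₀ y ∧ y T = 0

/-- The pair `{A, B}` is null controllable in time `T` along the eigenvector `φ`
(`j`-null controllable if `φ` is the `j`-th eigenvector). -/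
def IsNullControllable [NormedSpace ℝ X] (A : X →ₗ.[𝕜] X) (B : X →L[𝕜] X) (φ : X) (T : ℝ) : Prop :=
  ∃ N : ℝ, 0 < N ∧ ∀ y₀ : X, ∃ p : ℝ → 𝕜, SteersLinearToZero A B φ T y₀ p ∧
    controlNorm p T ≤ ENNReal.ofReal (N * ‖y₀‖)

/-- The control cost `N(T) = sup_{‖y₀‖ = 1} inf {‖p‖_{L²(0,T)} : y(T; y₀, p) = 0}`, as an extended
nonnegative real. -/
def controlCost [NormedSpace ℝ X] (A : X →ₗ.[𝕜] X) (B : X →L[𝕜] X) (φ : X) (T : ℝ) : ℝ≥0∞ :=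
  ⨆ (y₀ : X) (_ : ‖y₀‖ = 1), ⨅ (p : ℝ → 𝕜) (_ : SteersLinearToZero A B φ T y₀ p), controlNorm p T

/-- The bilinear system `u' + A u + p(t) B u = 0`, `u(0) = u₀`, can be steered exactly to the
eigensolution `ψ(t) = e^{-lam t} φ` in time `T` by some control `p ∈ L²(0,T)`. -/
def SteersToEigensolution [NormedSpace ℝ X] (A : X →ₗ.[𝕜] X) (B : X →L[𝕜] X) (lam : ℝ) (φ : X)
    (T : ℝ) (u₀ : X) : Prop :=
  ∃ p : ℝ → 𝕜, IsControl p T ∧ ∃ u : ℝ → X, IsMildSolution A B p 0 T u₀ u ∧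
    u T = ((Real.exp (-(lam * T)) : ℝ) : 𝕜) • φ

end

end BilinearControl

open MeasureTheory Set Filter Topology
open scoped ENNReal

namespace BilinearControl

/-! ### Functional calculus for a complete orthogonal family of subspaces. -/

section Diagonal

variable {𝕜 X ι : Type*} [RCLike 𝕜] [NormedAddCommGroup X] [InnerProductSpace 𝕜 X]
  {W : ι → Submodule 𝕜 X} [∀ i, (W i).HasOrthogonalProjection]

/-! Put `S t = e^{λ₁t} e^{-tA}`. Multiplying solutions by `e^{λ₁t}` replaces `A` by `A - λ₁` and
turns the target into the stationary state `φ₁`, while `S` is a contraction semigroup fixing `φ₁`.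
The error `v = u - φ₁` solves `v' + (A - λ₁)v + pBφ₁ + pBv = 0`. If `p` steers the linear system
(without `pBv`) from `v₀` to zero in time `τ`, then `v(τ)` is only the Duhamel integral of `-pBv`.
Both `p` and `v` are of size at most a constant times `N(τ)‖v₀‖`, so `v(τ)` is quadratic in that
quantity (`exists_isBilinearMild_of_steers`, `exists_isBilinearMild_quadratic`).

This step is iterated on intervals of lengths `T₁(3/4)^n`, of finite total length. The cost grows
like `exp(α(4/3)^n)`, but squaring doubles exponents at each step and `2 > 4/3`, so errors
`exp(-M(4/3)^n)` persist for `M` large. The pieces glue to a square-integrable control reaching `φ₁`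
exactly at the limit time (`exists_local_steering`, `exists_isBilinearMild_of_seq`).

To pass from a ball to a strip, let the system first evolve freely. A scalar control can null only
one direction of the `λ₁`-eigenspace, which is therefore spanned by `φ₁`
(`starProjection_eq_inner_smul`). The part of `u₀` orthogonal to `φ₁` thus decays at the rate of the
spectral gap, while the coefficient along `φ₁` is preserved; hence only that coefficient has to be
close to 1, uniformly in `R`. -/

theorem starProjection_starProjection_of_ne
    (hW : OrthogonalFamily 𝕜 (fun i => W i) fun i => (W i).subtypeₗᵢ) {i j : ι} (hij : i ≠ j)
    (x : X) : (W i).starProjection ((W j).starProjection x) = 0 := by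
  rw [Submodule.starProjection_apply_eq_zero_iff]
  exact (hW.isOrtho hij.symm).le (Submodule.starProjection_apply_mem _ _)

theorem starProjection_starProjection_self (i : ι) (x : X) :
    (W i).starProjection ((W i).starProjection x) = (W i).starProjection x :=
  Submodule.starProjection_eq_self_iff.2 (Submodule.starProjection_apply_mem _ _)

omit [∀ i, (W i).HasOrthogonalProjection] in
theorem starProjection_eq_zero_of_eq_bot {V : Submodule 𝕜 X} [V.HasOrthogonalProjection]
    (hV : V = ⊥) (x : X) : V.starProjection x = 0 := by
  subst hV
  simp

theorem starProjection_eq_of_hasSum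
    (hW : OrthogonalFamily 𝕜 (fun i => W i) fun i => (W i).subtypeₗᵢ)
    {f : ι → X} (hf : ∀ i, f i ∈ W i) {x : X} (hx : HasSum f x) (j : ι) :
    (W j).starProjection x = f j := by
  have h1 : HasSum (fun i => (W j).starProjection (f i)) ((W j).starProjection x) :=
    hx.mapL ((W j).starProjection)
  have h2 : HasSum (fun i => (W j).starProjection (f i)) ((W j).starProjection (f j)) := by
    refine hasSum_single j fun i hi => ?_
    rw [Submodule.starProjection_apply_eq_zero_iff]
    exact (hW.isOrtho hi).le (hf i)
  rw [h1.unique h2, Submodule.starProjection_eq_self_iff]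
  exact hf j

/-- Parseval: pair the expansion of `x` with `x` and take real parts. -/
theorem hasSum_norm_sq_starProjection {x : X} (hx : HasSum (fun i => (W i).starProjection x) x) :
    HasSum (fun i => ‖(W i).starProjection x‖ ^ 2) (‖x‖ ^ 2) := by
  have h := (hx.mapL (innerSL 𝕜 x)).mapL (RCLike.reCLM (K := 𝕜))
  simp only [innerSL_apply_apply, RCLike.reCLM_apply, inner_self_eq_norm_sq] at h
  refine h.congr_fun ?_ |> fun h => h
  intro i
  have := Submodule.re_inner_starProjection_eq_normSq (K := W i) x
  rw [inner_re_symm, this]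
  rfl

variable [CompleteSpace X]

theorem hasSum_starProjection [∀ i, CompleteSpace (W i)]
    (hW : OrthogonalFamily 𝕜 (fun i => W i) fun i => (W i).subtypeₗᵢ) (hT : (⨆ i, W i)ᗮ = ⊥)
    (x : X) : HasSum (fun i => (W i).starProjection x) x := by
  have hH : IsHilbertSum 𝕜 (fun i => W i) fun i => (W i).subtypeₗᵢ := by
    refine IsHilbertSum.mkInternal W hW ?_
    rw [Submodule.topologicalClosure_eq_top_iff.2 hT]
  have h := hH.hasSum_linearIsometryEquiv_symm (hH.linearIsometryEquiv x)
  rw [LinearIsometryEquiv.symm_apply_apply] at h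
  have h' := fun j => starProjection_eq_of_hasSum hW (fun i => Subtype.coe_prop _) h j
  simp_rw [h']
  exact h

/-- The operator acting as multiplication by `c i` on each subspace `W i`. -/
noncomputable def diagonal (W : ι → Submodule 𝕜 X) [∀ i, (W i).HasOrthogonalProjection]
    (c : ι → ℝ) (x : X) : X := ∑' i, ((c i : ℝ) : 𝕜) • (W i).starProjection x

variable (hW : OrthogonalFamily 𝕜 (fun i => W i) fun i => (W i).subtypeₗᵢ)
    (hsum : ∀ x : X, HasSum (fun i => (W i).starProjection x) x)

include hW hsum

/-- The bound on `c` is needed only where `W i` is nontrivial: the index set will be all of `ℝ`,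
most of it not spectrum, where the multipliers are unbounded. -/
theorem hasSum_diagonal {c : ι → ℝ} {C : ℝ} (hc : ∀ i, W i ≠ ⊥ → |c i| ≤ C) (x : X) :
    HasSum (fun i => ((c i : ℝ) : 𝕜) • (W i).starProjection x) (diagonal W c x) := by
  refine Summable.hasSum ?_
  refine (hW.summable_iff_norm_sq_summable
    fun i => (((c i : ℝ) : 𝕜) • (W i).orthogonalProjectionOnto x)).2 ?_
  refine Summable.of_nonneg_of_le (fun i => by positivity) (fun i => ?_)
    ((hasSum_norm_sq_starProjection (hsum x)).summable.mul_left (C ^ 2))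
  have h0 : ‖((c i : ℝ) : 𝕜) • (W i).orthogonalProjectionOnto x‖ =
      |c i| * ‖(W i).starProjection x‖ := by
    rw [norm_smul, RCLike.norm_ofReal]
    rfl
  rw [h0, mul_pow]
  by_cases hi : W i = ⊥
  · simp [starProjection_eq_zero_of_eq_bot hi]
  · gcongr
    exact hc i hi

theorem starProjection_diagonal {c : ι → ℝ} {C : ℝ} (hc : ∀ i, W i ≠ ⊥ → |c i| ≤ C) (x : X)
    (j : ι) : (W j).starProjection (diagonal W c x) = ((c j : ℝ) : 𝕜) • (W j).starProjection x :=
  starProjection_eq_of_hasSum hW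
    (fun _ => Submodule.smul_mem _ _ (Submodule.starProjection_apply_mem _ _))
    (hasSum_diagonal hW hsum hc x) j

omit hW [CompleteSpace X] in
theorem eq_of_starProjection_eq {x y : X}
    (h : ∀ i, (W i).starProjection x = (W i).starProjection y) : x = y := by
  refine (hsum x).unique ?_
  simp_rw [h]
  exact hsum y

omit hW [CompleteSpace X] in
theorem norm_le_of_norm_starProjection_le {x y : X} {C : ℝ} (hC : 0 ≤ C)
    (h : ∀ i, ‖(W i).starProjection x‖ ≤ C * ‖(W i).starProjection y‖) : ‖x‖ ≤ C * ‖y‖ := by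
  have h1 := hasSum_norm_sq_starProjection (hsum x)
  have h2 := (hasSum_norm_sq_starProjection (hsum y)).mul_left (C ^ 2)
  have h3 : ‖x‖ ^ 2 ≤ (C * ‖y‖) ^ 2 := by
    rw [mul_pow]
    refine hasSum_le (fun i => ?_) h1 h2
    rw [← mul_pow]
    exact pow_le_pow_left₀ (norm_nonneg _) (h i) 2
  exact le_of_sq_le_sq h3 (by positivity)

/-- `C` only makes the operator well defined. `C'` may be smaller since it sees only the components
present in `x`; this gives decay away from the first eigenspace. -/
theorem norm_diagonal_le {c : ι → ℝ} {C : ℝ} (hc : ∀ i, W i ≠ ⊥ → |c i| ≤ C)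
    {x : X} {C' : ℝ} (hC' : 0 ≤ C') (hx : ∀ i, (W i).starProjection x ≠ 0 → |c i| ≤ C') :
    ‖diagonal W c x‖ ≤ C' * ‖x‖ := by
  refine norm_le_of_norm_starProjection_le hsum hC' fun i => ?_
  rw [starProjection_diagonal hW hsum hc, norm_smul, RCLike.norm_ofReal]
  by_cases hi : (W i).starProjection x = 0
  · simp [hi]
  · gcongr
    exact hx i hi

/-- Parseval turns the squared increment into a series, and dominated convergence applies with terms
at most `(2C)²‖P_i x‖²`. -/
theorem continuous_diagonal {T : Type*} [TopologicalSpace T] {c : T → ι → ℝ} {C : ℝ}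
    (hc : ∀ t i, W i ≠ ⊥ → |c t i| ≤ C) (hcont : ∀ i, Continuous fun t => c t i) (x : X) :
    Continuous fun t => diagonal W (c t) x := by
  rw [continuous_iff_continuousAt]
  intro t₀
  have hd : ∀ t i, (W i).starProjection (diagonal W (c t) x - diagonal W (c t₀) x) =
      ((c t i - c t₀ i : ℝ) : 𝕜) • (W i).starProjection x := by
    intro t i
    rw [map_sub, starProjection_diagonal hW hsum (hc t), starProjection_diagonal hW hsum (hc t₀),
      RCLike.ofReal_sub, sub_smul]
  have hsq : ∀ t, ‖diagonal W (c t) x - diagonal W (c t₀) x‖ ^ 2 =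
      ∑' i, ‖((c t i - c t₀ i : ℝ) : 𝕜) • (W i).starProjection x‖ ^ 2 := by
    intro t
    rw [← (hasSum_norm_sq_starProjection (hsum _)).tsum_eq]
    simp_rw [hd]
  have hlim : Tendsto (fun t => ‖diagonal W (c t) x - diagonal W (c t₀) x‖ ^ 2) (𝓝 t₀) (𝓝 0) := by
    simp_rw [hsq]
    have := tendsto_tsum_of_dominated_convergence
      (f := fun t i => ‖((c t i - c t₀ i : ℝ) : 𝕜) • (W i).starProjection x‖ ^ 2)
      (g := fun _ => (0 : ℝ)) (𝓕 := 𝓝 t₀)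
      (bound := fun i => (2 * C) ^ 2 * ‖(W i).starProjection x‖ ^ 2)
      ((hasSum_norm_sq_starProjection (hsum x)).summable.mul_left _) (fun i => ?_) ?_
    · simpa using this
    · have : Continuous fun t => ‖((c t i - c t₀ i : ℝ) : 𝕜) • (W i).starProjection x‖ ^ 2 := by
        have := hcont i
        fun_prop
      have h := this.tendsto t₀
      simpa using h
    · refine Eventually.of_forall fun t i => ?_
      rw [norm_smul, mul_pow, RCLike.norm_ofReal, Real.norm_of_nonneg (by positivity)]
      by_cases hi : W i = ⊥
      · simp [starProjection_eq_zero_of_eq_bot hi]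
      · gcongr
        calc |c t i - c t₀ i| ≤ |c t i| + |c t₀ i| := abs_sub _ _
          _ ≤ 2 * C := by linarith [hc t i hi, hc t₀ i hi]
  rw [ContinuousAt, tendsto_iff_norm_sub_tendsto_zero]
  have := hlim.sqrt
  simpa [Real.sqrt_sq] using this

end Diagonal

/-! ### Spectral theory of `A` through its compact resolvent. -/

section Spectral

variable {𝕜 X : Type*} [RCLike 𝕜] [NormedAddCommGroup X] [InnerProductSpace 𝕜 X]
  {A : X →ₗ.[𝕜] X}

theorem mem_eigenspace_iff {mu : ℝ} {x : X} :
    x ∈ eigenspace A mu ↔ ∃ h : x ∈ A.domain, A ⟨x, h⟩ = (mu : 𝕜) • x := by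
  simp only [eigenspace, Submodule.mem_map, LinearMap.mem_ker, LinearMap.sub_apply,
    LinearMap.smul_apply, Submodule.subtype_apply, sub_eq_zero]
  constructor
  · rintro ⟨y, hy, rfl⟩
    exact ⟨y.2, hy⟩
  · rintro ⟨h, hx⟩
    exact ⟨⟨x, h⟩, hx, rfl⟩

/-- The dictionary that transfers the spectral theorem for compact symmetric operators to the
unbounded `A`. -/
theorem IsShiftedInverse.mem_eigenspace_iff {m : ℝ} {K : X →L[𝕜] X} (hK : IsShiftedInverse A m K)
    {mu : ℝ} (hmu : m + mu ≠ 0) {x : X} :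
    x ∈ eigenspace A mu ↔ K x = (((m + mu)⁻¹ : ℝ) : 𝕜) • x := by
  have hne : ((m : 𝕜) + (mu : 𝕜)) ≠ 0 := by exact_mod_cast hmu
  rw [BilinearControl.mem_eigenspace_iff]
  push_cast
  constructor
  · rintro ⟨h, hx⟩
    have := hK.2 ⟨x, h⟩
    rw [hx] at this
    simp only [← add_smul, map_smul] at this
    rw [eq_inv_smul_iff₀ hne, this]
  · intro hx
    obtain ⟨h, hx'⟩ := hK.1 x
    have hdom : x ∈ A.domain := by
      have := A.domain.smul_mem ((m : 𝕜) + mu) h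
      rwa [hx, smul_inv_smul₀ hne] at this
    refine ⟨hdom, ?_⟩
    have h2 : (⟨K x, h⟩ : A.domain) = ((m : 𝕜) + mu)⁻¹ • ⟨x, hdom⟩ := Subtype.ext hx
    rw [h2, A.map_smul, hx, smul_comm, ← smul_add, inv_smul_eq_iff₀ hne, add_smul] at hx'
    exact add_left_cancel hx'

variable [CompleteSpace X]

theorem IsSemiboundedCompactResolvent.inner_symm
    (hA : IsSemiboundedCompactResolvent A 0) (x y : A.domain) :
    inner 𝕜 (A x) (y : X) = inner 𝕜 (x : X) (A y) := by
  have h := LinearPMap.adjoint_isFormalAdjoint hA.dense_domain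
  rw [LinearPMap.isSelfAdjoint_def.1 hA.selfAdjoint] at h
  exact h x y

theorem IsShiftedInverse.isSymmetric (hA : IsSemiboundedCompactResolvent A 0) {m : ℝ}
    {K : X →L[𝕜] X} (hK : IsShiftedInverse A m K) : (K : X →ₗ[𝕜] X).IsSymmetric := by
  intro x y
  obtain ⟨hx, hx'⟩ := hK.1 x
  obtain ⟨hy, hy'⟩ := hK.1 y
  have := hA.inner_symm ⟨K x, hx⟩ ⟨K y, hy⟩
  calc inner 𝕜 (K x) y = inner 𝕜 (K x) ((m : 𝕜) • K y + A ⟨K y, hy⟩) := by rw [hy']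
    _ = inner 𝕜 ((m : 𝕜) • K x + A ⟨K x, hx⟩) (K y) := by
      simp only [inner_add_left, inner_add_right, inner_smul_left, inner_smul_right,
        RCLike.conj_ofReal]
      rw [← this]
    _ = inner 𝕜 x (K y) := by rw [hx']

omit [CompleteSpace X] in
theorem IsShiftedInverse.injective {m : ℝ} {K : X →L[𝕜] X} (hK : IsShiftedInverse A m K) {x : X}
    (hx : K x = 0) : x = 0 := by
  obtain ⟨h, h'⟩ := hK.1 x
  have : (⟨K x, h⟩ : A.domain) = 0 := Subtype.ext hx
  rw [← h', this, hx, smul_zero, A.map_zero, zero_add]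

theorem IsSemiboundedCompactResolvent.nonneg_of_eigenspace_ne_bot
    (hA : IsSemiboundedCompactResolvent A 0) {mu : ℝ} (h : eigenspace A mu ≠ ⊥) : 0 ≤ mu := by
  obtain ⟨x, hx, hx0⟩ := Submodule.exists_mem_ne_zero_of_ne_bot h
  obtain ⟨hd, hx'⟩ := mem_eigenspace_iff.1 hx
  have := hA.bounded_below ⟨x, hd⟩
  rw [hx', inner_smul_left, RCLike.conj_ofReal, RCLike.re_ofReal_mul, inner_self_eq_norm_sq] at this
  have hpos : 0 < ‖x‖ ^ 2 := by positivity
  simp only [neg_zero, zero_mul] at this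
  exact nonneg_of_mul_nonneg_left this hpos

theorem IsSemiboundedCompactResolvent.isClosed_eigenspace
    (hA : IsSemiboundedCompactResolvent A 0) (mu : ℝ) : IsClosed (eigenspace A mu : Set X) := by
  obtain ⟨m, hm, K, hK, -⟩ := hA.compact_resolvent
  by_cases h : eigenspace A mu = ⊥
  · rw [h]
    exact isClosed_singleton
  · have hne : m + mu ≠ 0 := by linarith [hA.nonneg_of_eigenspace_ne_bot h] |> ne_of_gt
    have : (eigenspace A mu : Set X) = {x | K x = (((m + mu)⁻¹ : ℝ) : 𝕜) • x} := by
      ext x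
      exact hK.mem_eigenspace_iff hne
    rw [this]
    exact isClosed_eq (by fun_prop) (by fun_prop)

theorem IsSemiboundedCompactResolvent.topologicalClosure_eigenspace
    (hA : IsSemiboundedCompactResolvent A 0) (mu : ℝ) :
    (eigenspace A mu).topologicalClosure = eigenspace A mu :=
  (hA.isClosed_eigenspace mu).submodule_topologicalClosure_eq

theorem IsSemiboundedCompactResolvent.orthogonalFamily
    (hA : IsSemiboundedCompactResolvent A 0) :
    OrthogonalFamily 𝕜 (fun mu : ℝ => (eigenspace A mu).topologicalClosure)
      fun mu => ((eigenspace A mu).topologicalClosure).subtypeₗᵢ := by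
  intro mu nu hne x y
  obtain ⟨x, hx⟩ := x
  obtain ⟨y, hy⟩ := y
  rw [hA.topologicalClosure_eigenspace] at hx hy
  obtain ⟨hxd, hx'⟩ := mem_eigenspace_iff.1 hx
  obtain ⟨hyd, hy'⟩ := mem_eigenspace_iff.1 hy
  have h := hA.inner_symm ⟨x, hxd⟩ ⟨y, hyd⟩
  rw [hx', hy', inner_smul_left, inner_smul_right, RCLike.conj_ofReal, ← sub_eq_zero,
    ← sub_mul, mul_eq_zero] at h
  refine h.resolve_left ?_
  rw [sub_eq_zero]
  exact_mod_cast hne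

/-- Eigenvectors of the compact symmetric resolvent `K` are total. Each eigenvalue `κ` of `K` is
real, and nonzero because `K` is injective, so its eigenspace lies in that of `A` for `κ⁻¹ - m`. -/
theorem IsSemiboundedCompactResolvent.orthogonal_iSup_eigenspace
    (hA : IsSemiboundedCompactResolvent A 0) :
    (⨆ mu : ℝ, (eigenspace A mu).topologicalClosure)ᗮ = ⊥ := by
  obtain ⟨m, hm, K, hK, hKc⟩ := hA.compact_resolvent
  rw [eq_bot_iff, ← ContinuousLinearMap.orthogonalComplement_iSup_eigenspaces_eq_bot hKc
    (hK.isSymmetric hA)]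
  refine Submodule.orthogonal_le (iSup_le fun κ => ?_)
  intro x hx
  by_cases hx0 : x = 0
  · rw [hx0]
    exact Submodule.zero_mem _
  rw [Module.End.mem_eigenspace_iff] at hx
  have hev : Module.End.HasEigenvalue (K : X →ₗ[𝕜] X) κ :=
    Module.End.hasEigenvalue_of_hasEigenvector ⟨Module.End.mem_eigenspace_iff.2 hx, hx0⟩
  have hreal : ((RCLike.re κ : ℝ) : 𝕜) = κ :=
    RCLike.conj_eq_iff_re.1 ((hK.isSymmetric hA).conj_eigenvalue_eq_self hev)
  have hκ : RCLike.re κ ≠ 0 := by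
    intro h0
    rw [h0, RCLike.ofReal_zero] at hreal
    rw [← hreal, zero_smul] at hx
    exact hx0 (hK.injective hx)
  refine Submodule.mem_iSup_of_mem ((RCLike.re κ)⁻¹ - m) (Submodule.le_topologicalClosure _ ?_)
  have hsum : m + ((RCLike.re κ)⁻¹ - m) = (RCLike.re κ)⁻¹ := by ring
  rw [hK.mem_eigenspace_iff (by rw [hsum]; exact inv_ne_zero hκ), hsum, inv_inv, hreal]
  exact hx

/-- Infinitely many eigenvalues below `lam + 1` would give orthonormal eigenvectors whose images
under `K` are uniformly separated, contradicting compactness. So the spectrum there is finite. -/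
theorem IsSemiboundedCompactResolvent.exists_gap
    (hA : IsSemiboundedCompactResolvent A 0) (lam : ℝ) :
    ∃ γ : ℝ, 0 < γ ∧ ∀ mu : ℝ, eigenspace A mu ≠ ⊥ → lam < mu → lam + γ ≤ mu := by
  obtain ⟨m, hm, K, hK, hKc⟩ := hA.compact_resolvent
  have hfin : {mu : ℝ | eigenspace A mu ≠ ⊥ ∧ mu ≤ lam + 1}.Finite := by
    by_contra hinf
    have hinf : {mu : ℝ | eigenspace A mu ≠ ⊥ ∧ mu ≤ lam + 1}.Infinite := hinf
    let s := hinf.natEmbedding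
    have hs : ∀ n, ∃ x : X, x ∈ eigenspace A (s n) ∧ ‖x‖ = 1 := by
      intro n
      obtain ⟨x, hx, hx0⟩ := Submodule.exists_mem_ne_zero_of_ne_bot (s n).2.1
      refine ⟨((‖x‖⁻¹ : ℝ) : 𝕜) • x, Submodule.smul_mem _ _ hx, ?_⟩
      rw [norm_smul, RCLike.norm_ofReal, abs_of_nonneg (by positivity)]
      exact inv_mul_cancel₀ (norm_ne_zero_iff.2 hx0)
    choose e he he1 using hs
    have hpos : ∀ n, 0 < m + (s n : ℝ) := fun n => by
      linarith [hA.nonneg_of_eigenspace_ne_bot (s n).2.1]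
    have hKe : ∀ n, K (e n) = (((m + s n)⁻¹ : ℝ) : 𝕜) • e n := fun n =>
      (hK.mem_eigenspace_iff (hpos n).ne').1 (he n)
    have hdist : ∀ i j, i ≠ j → (m + lam + 1)⁻¹ ≤ ‖K (e i) - K (e j)‖ := by
      intro i j hij
      have horth : inner 𝕜 (K (e i)) (K (e j)) = 0 := by
        have hne : (s i : ℝ) ≠ s j := fun h => hij (s.injective (Subtype.ext h))
        have := hA.orthogonalFamily hne ⟨e i, Submodule.le_topologicalClosure _ (he i)⟩
          ⟨e j, Submodule.le_topologicalClosure _ (he j)⟩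
        rw [hKe, hKe, inner_smul_left, inner_smul_right]
        have this : inner 𝕜 (e i) (e j) = 0 := this
        rw [this, mul_zero, mul_zero]
      have hsq : ‖K (e i) - K (e j)‖ ^ 2 = ‖K (e i)‖ ^ 2 + ‖K (e j)‖ ^ 2 := by
        rw [@norm_sub_sq 𝕜, horth]
        simp
      have hi : (m + lam + 1)⁻¹ ≤ ‖K (e i)‖ := by
        rw [hKe, norm_smul, he1, mul_one, RCLike.norm_ofReal,
          abs_of_pos (inv_pos.2 (hpos i))]
        exact inv_anti₀ (hpos i) (by linarith [(s i).2.2])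
      refine hi.trans (le_of_sq_le_sq ?_ (norm_nonneg _))
      rw [hsq]
      linarith [sq_nonneg ‖K (e j)‖]
    have hmlam : 0 < m + lam + 1 := by linarith [hpos 0, (s 0).2.2]
    obtain ⟨C, hC, hCsub⟩ := hKc.image_closedBall_subset_compact (f := (K : X →ₗ[𝕜] X)) 1
    have hmem : ∀ n, K (e n) ∈ C := fun n =>
      hCsub ⟨e n, by simp [he1 n], rfl⟩
    obtain ⟨a, -, ψ, hψ, hlim⟩ := hC.tendsto_subseq hmem
    have hcau := hlim.cauchySeq
    rw [Metric.cauchySeq_iff] at hcau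
    obtain ⟨N, hN⟩ := hcau (m + lam + 1)⁻¹ (inv_pos.2 hmlam)
    have := hN N le_rfl (N + 1) (Nat.le_succ N)
    rw [dist_eq_norm] at this
    exact absurd this (not_lt.2 (hdist _ _ (hψ.injective.ne (Nat.succ_ne_self N).symm)))
  obtain ⟨γ, hγ, hγ'⟩ : ∃ γ : ℝ, 0 < γ ∧ ∀ mu ∈ {mu : ℝ | eigenspace A mu ≠ ⊥ ∧ mu ≤ lam + 1},
      lam < mu → lam + γ ≤ mu := by
    have hgap : ∀ s : Set ℝ, s.Finite → ∃ γ : ℝ, 0 < γ ∧ ∀ mu ∈ s, lam < mu → lam + γ ≤ mu := by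
      intro s hs
      induction s, hs using Set.Finite.induction_on with
      | empty => exact ⟨1, one_pos, by simp⟩
      | @insert a s _ _ ih =>
        obtain ⟨γ, hγ, h⟩ := ih
        by_cases ha : lam < a
        · refine ⟨min γ (a - lam), lt_min hγ (sub_pos.2 ha), ?_⟩
          rintro mu (rfl | hmu) hlt
          · linarith [min_le_right γ (mu - lam)]
          · linarith [min_le_left γ (a - lam), h mu hmu hlt]
        · refine ⟨γ, hγ, ?_⟩
          rintro mu (rfl | hmu) hlt
          · exact absurd hlt ha
          · exact h mu hmu hlt
    exact hgap _ hfin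
  refine ⟨min γ 1, lt_min hγ one_pos, fun mu hmu hlt => ?_⟩
  by_cases h1 : mu ≤ lam + 1
  · linarith [min_le_left γ 1, hγ' mu ⟨hmu, h1⟩ hlt]
  · linarith [min_le_right γ 1]

end Spectral

/-- A strongly continuous semigroup of contractions `S t`, `t ≥ 0`, extended to negative times in
some strongly continuous and contractive way. -/
structure IsContractionSemigroup {𝕜 X : Type*} [RCLike 𝕜] [NormedAddCommGroup X]
    [InnerProductSpace 𝕜 X] (S : ℝ → X →L[𝕜] X) : Prop where
  zero_apply : ∀ x, S 0 x = x
  add_apply : ∀ s t, 0 ≤ s → 0 ≤ t → ∀ x, S (s + t) x = S s (S t x)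
  norm_apply_le : ∀ t x, ‖S t x‖ ≤ ‖x‖
  continuous_apply : ∀ x, Continuous fun t => S t x

/-! ### The rescaled semigroup and its decay off the first eigenspace. -/

section Spectral

variable {𝕜 X : Type*} [RCLike 𝕜] [NormedAddCommGroup X] [InnerProductSpace 𝕜 X]
  [CompleteSpace X] {A : X →ₗ.[𝕜] X}

theorem IsSemiboundedCompactResolvent.exists_contractionSemigroup
    (hA : IsSemiboundedCompactResolvent A 0) {lam : ℝ}
    (hlam : ∀ mu : ℝ, eigenspace A mu ≠ ⊥ → lam ≤ mu) :
    ∃ (S : ℝ → X →L[𝕜] X) (γ : ℝ), 0 < γ ∧ IsContractionSemigroup S ∧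
      (∀ t, 0 ≤ t → ∀ x, S t x = ((Real.exp (lam * t) : ℝ) : 𝕜) • semigroup A t x) ∧
      (∀ t x, (eigenspace A lam).topologicalClosure.starProjection (S t x) =
        (eigenspace A lam).topologicalClosure.starProjection x) ∧
      (∀ t, ∀ x ∈ eigenspace A lam, S t x = x) ∧
      ∀ t, 0 ≤ t → ∀ x, (eigenspace A lam).topologicalClosure.starProjection x = 0 →
        ‖S t x‖ ≤ Real.exp (-(γ * t)) * ‖x‖ := by
  classical
  obtain ⟨γ, hγ, hgap⟩ := hA.exists_gap lam
  let W : ℝ → Submodule 𝕜 X := fun mu => (eigenspace A mu).topologicalClosure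
  have hW : OrthogonalFamily 𝕜 (fun mu => W mu) fun mu => (W mu).subtypeₗᵢ := hA.orthogonalFamily
  have hsum : ∀ x, HasSum (fun mu => (W mu).starProjection x) x :=
    hasSum_starProjection hW hA.orthogonal_iSup_eigenspace
  have hWbot : ∀ mu, W mu ≠ ⊥ → lam ≤ mu := fun mu h => hlam mu fun h' => h (by
    simp only [W]
    rw [hA.topologicalClosure_eigenspace, h'])
  -- `max t 0` freezes the family at the identity for negative times, so contractivity and
  -- continuity hold on all of `ℝ` and `S (t - s)` needs no restriction on `s`.
  let c : ℝ → ℝ → ℝ := fun t mu => Real.exp (-(max t 0 * (mu - lam)))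
  have hc : ∀ t mu, W mu ≠ ⊥ → |c t mu| ≤ 1 := by
    intro t mu h
    rw [abs_of_pos (Real.exp_pos _), Real.exp_le_one_iff, neg_nonpos]
    exact mul_nonneg (le_max_right _ _) (sub_nonneg.2 (hWbot mu h))
  have hPd := fun t x => starProjection_diagonal hW hsum (hc t) x
  let S : ℝ → X →L[𝕜] X := fun t => LinearMap.mkContinuous
    { toFun := fun x => diagonal W (c t) x
      map_add' := fun x y => eq_of_starProjection_eq hsum fun i => by
        simp only [map_add, hPd, smul_add]
      map_smul' := fun a x => eq_of_starProjection_eq hsum fun i => by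
        simp only [map_smul, hPd, RingHom.id_apply, smul_comm a] } 1
    (fun x => norm_diagonal_le hW hsum (hc t) zero_le_one fun i hi =>
      hc t i fun h => hi (starProjection_eq_zero_of_eq_bot h x))
  have hS : ∀ t x, S t x = diagonal W (c t) x := fun t x => rfl
  have hPS : ∀ t x i, (W i).starProjection (S t x) = ((c t i : ℝ) : 𝕜) • (W i).starProjection x :=
    hPd
  have hnorm : ∀ t x (C : ℝ), 0 ≤ C → (∀ i, (W i).starProjection x ≠ 0 → c t i ≤ C) →
      ‖S t x‖ ≤ C * ‖x‖ := by
    intro t x C hC h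
    refine norm_diagonal_le hW hsum (hc t) hC fun i hi => ?_
    rw [abs_of_pos (Real.exp_pos _)]
    exact h i hi
  refine ⟨S, γ, hγ, ⟨?_, ?_, ?_, ?_⟩, ?_, ?_, ?_, ?_⟩
  · intro x
    refine eq_of_starProjection_eq hsum fun i => ?_
    rw [hPS]
    simp [c]
  · intro s t hs ht x
    refine eq_of_starProjection_eq hsum fun i => ?_
    rw [hPS, hPS, hPS, smul_smul, ← RCLike.ofReal_mul, ← Real.exp_add, max_eq_left hs,
      max_eq_left ht]
    simp only [c]
    rw [max_eq_left (add_nonneg hs ht)]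
    congr 4
    ring
  · intro t x
    rw [← one_mul ‖x‖]
    refine hnorm t x 1 zero_le_one fun i hi => ?_
    have := hc t i fun h => hi (starProjection_eq_zero_of_eq_bot h x)
    exact (le_abs_self _).trans this
  · exact fun x => continuous_diagonal hW hsum hc (fun i => by fun_prop) x
  · intro t ht x
    rw [hS, diagonal, semigroup, ← tsum_const_smul'']
    refine tsum_congr fun mu => ?_
    rw [smul_smul, ← RCLike.ofReal_mul, ← Real.exp_add]
    simp only [c, W]
    rw [max_eq_left ht]
    congr 4
    ring
  · intro t x
    have := hPS t x lam
    simpa [c, W] using this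
  · intro t x hx
    have hx' : x ∈ W lam := Submodule.le_topologicalClosure _ hx
    refine eq_of_starProjection_eq hsum fun i => ?_
    rw [hPS]
    by_cases hi : i = lam
    · simp [hi, c]
    · rw [← Submodule.starProjection_eq_self_iff.2 hx', starProjection_starProjection_of_ne hW hi,
        smul_zero]
  · intro t ht x hx
    refine hnorm t x _ (Real.exp_pos _).le fun i hi => ?_
    have hlt : lam < i := by
      refine lt_of_le_of_ne (hWbot i fun h => hi (starProjection_eq_zero_of_eq_bot h x)) ?_
      rintro rfl
      exact hi hx
    have hgap' := hgap i (fun h => hi (starProjection_eq_zero_of_eq_bot (by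
      simp only [W]
      rw [hA.topologicalClosure_eigenspace, h]) x)) hlt
    rw [Real.exp_le_exp, max_eq_left ht, neg_le_neg_iff, mul_comm γ]
    exact mul_le_mul_of_nonneg_left (by linarith) ht

end Spectral

/-! ### The Duhamel integral of a contraction semigroup. -/

section Duhamel

variable {𝕜 X : Type*} [RCLike 𝕜] [NormedAddCommGroup X] [InnerProductSpace 𝕜 X]
  {S : ℝ → X →L[𝕜] X}

/-- Strong continuity and the uniform bound give joint continuity, hence measurability of `s ↦ S (t
- s) (f s)`. -/
theorem IsContractionSemigroup.continuous_uncurry (hS : IsContractionSemigroup S) :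
    Continuous fun q : ℝ × X => S q.1 q.2 := by
  rw [continuous_iff_continuousAt]
  rintro ⟨t, x⟩
  have h : Tendsto (fun q : ℝ × X => S q.1 x + S q.1 (q.2 - x)) (𝓝 (t, x)) (𝓝 (S t x + 0)) := by
    refine Tendsto.add ?_ ?_
    · exact ((hS.continuous_apply x).comp continuous_fst).tendsto (t, x)
    · refine squeeze_zero_norm (fun q => hS.norm_apply_le q.1 (q.2 - x)) ?_
      have : Continuous fun q : ℝ × X => ‖q.2 - x‖ := by fun_prop
      simpa using this.tendsto (t, x)
  simpa [ContinuousAt] using h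

theorem IsContractionSemigroup.aestronglyMeasurable (hS : IsContractionSemigroup S) {f : ℝ → X}
    {μ : Measure ℝ} (hf : AEStronglyMeasurable f μ) (t : ℝ) :
    AEStronglyMeasurable (fun s => S (t - s) (f s)) μ :=
  hS.continuous_uncurry.comp_aestronglyMeasurable
    (((continuous_const.sub continuous_id).aestronglyMeasurable).prodMk hf)

theorem IsContractionSemigroup.intervalIntegrable (hS : IsContractionSemigroup S) {f : ℝ → X}
    {a b : ℝ} (hf : IntervalIntegrable f volume a b) (t : ℝ) :
    IntervalIntegrable (fun s => S (t - s) (f s)) volume a b :=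
  hf.mono_fun (hS.aestronglyMeasurable hf.aestronglyMeasurable_restrict_uIoc t)
    (Eventually.of_forall fun _ => hS.norm_apply_le _ _)

variable [NormedSpace ℝ X]

/-- The Duhamel integral `∫₀ᵗ S(t - s) f(s) ds`. -/
noncomputable def duhamel (S : ℝ → X →L[𝕜] X) (f : ℝ → X) (t : ℝ) : X :=
  ∫ s in (0 : ℝ)..t, S (t - s) (f s)

theorem IsContractionSemigroup.norm_duhamel_le (hS : IsContractionSemigroup S) {f : ℝ → X} {t : ℝ}
    (ht : 0 ≤ t) {g : ℝ → ℝ} (hg : IntervalIntegrable g volume 0 t)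
    (hfg : ∀ s ∈ Ioo 0 t, ‖f s‖ ≤ g s) : ‖duhamel S f t‖ ≤ ∫ s in (0 : ℝ)..t, g s := by
  refine intervalIntegral.norm_integral_le_of_norm_le ht ?_ hg
  have h : ∀ᵐ s : ℝ, s ≠ t := by simp [ae_iff]
  filter_upwards [h] with s hs hs'
  exact (hS.norm_apply_le _ _).trans (hfg s ⟨hs'.1, lt_of_le_of_ne hs'.2 hs⟩)

theorem IsContractionSemigroup.continuousOn_duhamel (hS : IsContractionSemigroup S) {f : ℝ → X}
    {T : ℝ} (hT : 0 ≤ T) (hf : IntervalIntegrable f volume 0 T) :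
    ContinuousOn (duhamel S f) (Icc 0 T) := by
  -- The variable endpoint is moved into an indicator over the fixed interval. The integrand is then
  -- dominated by `‖f s‖` and continuous in `t` at `t₀` for every `s ≠ t₀`.
  have hcont : Continuous fun t =>
      ∫ s in (0 : ℝ)..T, (Iio t).indicator (fun s => S (t - s) (f s)) s := by
    rw [continuous_iff_continuousAt]
    intro t₀
    refine intervalIntegral.continuousAt_of_dominated_interval (bound := fun s => ‖f s‖)
      (Eventually.of_forall fun t => ?_) (Eventually.of_forall fun t => Eventually.of_forall ?_)
      hf.norm ?_
    · exact (hS.aestronglyMeasurable hf.aestronglyMeasurable_restrict_uIoc t).indicator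
        measurableSet_Iio
    · intro s _
      exact (norm_indicator_le_norm_self _ _).trans (hS.norm_apply_le _ _)
    · have h : ∀ᵐ s : ℝ, s ≠ t₀ := by simp [ae_iff]
      filter_upwards [h] with s hs _
      rcases lt_or_gt_of_ne hs with hlt | hgt
      · have h1 : ContinuousAt (fun t => S (t - s) (f s)) t₀ :=
          ((hS.continuous_apply (f s)).comp (continuous_id.sub continuous_const)).continuousAt
        refine h1.congr ?_
        filter_upwards [lt_mem_nhds hlt] with t ht
        simp [indicator, ht]
      · refine (continuousAt_const (y := (0 : X))).congr ?_
        filter_upwards [gt_mem_nhds hgt] with t ht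
        simp [indicator, ht.le]
  refine hcont.continuousOn.congr fun t ht => ?_
  change duhamel S f t = ∫ s in (0 : ℝ)..T, (Iio t).indicator (fun s => S (t - s) (f s)) s
  rw [duhamel, intervalIntegral.integral_of_le ht.1, intervalIntegral.integral_of_le hT,
    setIntegral_indicator measurableSet_Iio]
  have : Ioc 0 T ∩ Iio t = Ioo 0 t := by
    ext s
    simp only [mem_inter_iff, mem_Ioc, mem_Iio, mem_Ioo]
    constructor
    · rintro ⟨⟨h1, _⟩, h2⟩
      exact ⟨h1, h2⟩
    · rintro ⟨h1, h2⟩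
      exact ⟨⟨h1, h2.le.trans ht.2⟩, h2⟩
  rw [this, integral_Ioc_eq_integral_Ioo]

theorem IsContractionSemigroup.duhamel_add_fun (hS : IsContractionSemigroup S) {f g : ℝ → X} {t : ℝ}
    (hf : IntervalIntegrable f volume 0 t) (hg : IntervalIntegrable g volume 0 t) :
    duhamel S (fun s => f s + g s) t = duhamel S f t + duhamel S g t := by
  simp only [duhamel, map_add]
  exact intervalIntegral.integral_add (hS.intervalIntegrable hf t) (hS.intervalIntegrable hg t)

theorem duhamel_congr {f g : ℝ → X} {t : ℝ} (ht : 0 ≤ t) (h : ∀ s ∈ Ioo 0 t, f s = g s) :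
    duhamel S f t = duhamel S g t := by
  refine intervalIntegral.integral_congr_ae ?_
  have h0 : ∀ᵐ s : ℝ, s ≠ t := by simp [ae_iff]
  filter_upwards [h0] with s hs hs'
  rw [uIoc_of_le ht] at hs'
  rw [h s ⟨hs'.1, lt_of_le_of_ne hs'.2 hs⟩]

theorem IsContractionSemigroup.duhamel_add [CompleteSpace X] (hS : IsContractionSemigroup S)
    {f : ℝ → X}
    {a r : ℝ} (ha : 0 ≤ a) (hr : 0 ≤ r) (hf : IntervalIntegrable f volume 0 (a + r)) :
    duhamel S f (a + r) = S r (duhamel S f a) + duhamel S (fun s => f (s + a)) r := by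
  have h1 : IntervalIntegrable f volume 0 a :=
    hf.mono_set (by
      rw [uIcc_of_le ha, uIcc_of_le (by linarith)]
      exact Icc_subset_Icc le_rfl (by linarith))
  have h2 : IntervalIntegrable f volume a (a + r) :=
    hf.mono_set (by
      rw [uIcc_of_le (by linarith), uIcc_of_le (by linarith)]
      exact Icc_subset_Icc ha le_rfl)
  rw [duhamel, ← intervalIntegral.integral_add_adjacent_intervals
    (hS.intervalIntegrable h1 (a + r)) (hS.intervalIntegrable h2 (a + r))]
  congr 1
  · rw [duhamel, ← ContinuousLinearMap.intervalIntegral_comp_comm (S r) (hS.intervalIntegrable h1 a)]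
    refine intervalIntegral.integral_congr fun s hs => ?_
    rw [uIcc_of_le ha] at hs
    rw [← hS.add_apply r (a - s) hr (sub_nonneg.2 hs.2)]
    congr 2
    ring
  · have := intervalIntegral.integral_comp_add_right (a := 0) (b := r)
      (fun s => S (a + r - s) (f s)) a
    rw [zero_add, add_comm r a] at this
    rw [← this, duhamel]
    refine intervalIntegral.integral_congr fun s _ => ?_
    congr 2
    ring

end Duhamel

/-! ### Bilinear mild solutions: existence, concatenation, quadratic error. -/

section MildSolution

variable {𝕜 X : Type*} [RCLike 𝕜] [NormedAddCommGroup X] [InnerProductSpace 𝕜 X]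
  {S : ℝ → X →L[𝕜] X} {B : X →L[𝕜] X} {p : ℝ → 𝕜} {T : ℝ}

theorem intervalIntegrable_smul_apply (hT : 0 ≤ T) (hp : IntervalIntegrable p volume 0 T)
    {u : ℝ → X} (hu : ContinuousOn u (Icc 0 T)) :
    IntervalIntegrable (fun s => p s • B (u s)) volume 0 T := by
  refine hp.smul_continuousOn ?_
  rw [uIcc_of_le hT]
  exact B.continuous.comp_continuousOn hu

theorem intervalIntegrable_of_mem_Icc {E : Type*} [NormedAddCommGroup E] {f : ℝ → E}
    (hf : IntervalIntegrable f volume 0 T) {t : ℝ} (ht : t ∈ Icc 0 T) :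
    IntervalIntegrable f volume 0 t :=
  hf.mono_set (by
    rw [uIcc_of_le ht.1, uIcc_of_le (ht.1.trans ht.2)]
    exact Icc_subset_Icc le_rfl ht.2)

variable [NormedSpace ℝ X]

theorem IsContractionSemigroup.norm_duhamel_smul_apply_le (hS : IsContractionSemigroup S)
    (hp : IntervalIntegrable p volume 0 T) {u : ℝ → X} {C : ℝ}
    {t : ℝ} (ht : t ∈ Icc 0 T) (hu : ∀ s ∈ Ioo 0 t, ‖u s‖ ≤ C) (hC : 0 ≤ C) :
    ‖duhamel S (fun s => p s • B (u s)) t‖ ≤ (‖B‖ * ∫ s in (0 : ℝ)..T, ‖p s‖) * C := by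
  have hpt := intervalIntegrable_of_mem_Icc hp ht
  calc ‖duhamel S (fun s => p s • B (u s)) t‖ ≤ ∫ s in (0 : ℝ)..t, ‖p s‖ * (‖B‖ * C) := by
        refine hS.norm_duhamel_le ht.1 (hpt.norm.mul_const _) fun s hs => ?_
        rw [norm_smul]
        gcongr
        exact (B.le_opNorm _).trans (by gcongr; exact hu s hs)
    _ = (∫ s in (0 : ℝ)..t, ‖p s‖) * (‖B‖ * C) := intervalIntegral.integral_mul_const _ _
    _ ≤ (∫ s in (0 : ℝ)..T, ‖p s‖) * (‖B‖ * C) := by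
        gcongr
        exact intervalIntegral.integral_mono_interval le_rfl ht.1 ht.2
          (Eventually.of_forall fun _ => norm_nonneg _) hp.norm
    _ = _ := by ring

/-- Banach fixed point in `C([0,T]; X)`: the smallness of `‖B‖ ‖p‖_{L¹}` makes the map
`1/2`-Lipschitz at once. -/
theorem IsContractionSemigroup.exists_continuousOn_eq_add_duhamel [CompleteSpace X]
    (hS : IsContractionSemigroup S) (hT : 0 ≤ T) (hp : IntervalIntegrable p volume 0 T)
    (hB : ‖B‖ * ∫ s in (0 : ℝ)..T, ‖p s‖ ≤ 1 / 2) {g : ℝ → X} (hg : ContinuousOn g (Icc 0 T)) :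
    ∃ v : ℝ → X, ContinuousOn v (Icc 0 T) ∧
      ∀ t ∈ Icc 0 T, v t = g t + duhamel S (fun s => p s • B (v s)) t := by
  have hext : ∀ v : C(Icc (0 : ℝ) T, X), Continuous (IccExtend hT v) :=
    fun v => v.continuous.Icc_extend'
  let Φ : C(Icc (0 : ℝ) T, X) → C(Icc (0 : ℝ) T, X) := fun v =>
    ⟨fun t => g t + duhamel S (fun s => p s • B (IccExtend hT v s)) t,
      (hg.add (hS.continuousOn_duhamel hT (intervalIntegrable_smul_apply hT hp
        (hext v).continuousOn))).domRestrict⟩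
  have hΦ_apply : ∀ v t, Φ v t =
      g t + duhamel S (fun s => p s • B (IccExtend hT v s)) t := fun _ _ => rfl
  have hΦ : ContractingWith (1 / 2 : NNReal) Φ := by
    refine ⟨by
      rw [← NNReal.coe_lt_coe]
      norm_num, LipschitzWith.of_dist_le_mul fun v w => ?_⟩
    rw [ContinuousMap.dist_le (by positivity)]
    intro t
    have hlin : duhamel S (fun s => p s • B (IccExtend hT v s)) t =
        duhamel S (fun s => p s • B (IccExtend hT v s - IccExtend hT w s)) t +
          duhamel S (fun s => p s • B (IccExtend hT w s)) t := by
      rw [← hS.duhamel_add_fun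
        (intervalIntegrable_smul_apply (u := fun s => IccExtend hT v s - IccExtend hT w s) t.2.1
          (intervalIntegrable_of_mem_Icc hp t.2) ((hext v).sub (hext w)).continuousOn)
        (intervalIntegrable_smul_apply t.2.1 (intervalIntegrable_of_mem_Icc hp t.2)
          (hext w).continuousOn)]
      refine duhamel_congr t.2.1 fun s _ => ?_
      rw [← smul_add, ← map_add, sub_add_cancel]
    have hsub : Φ v t - Φ w t =
        duhamel S (fun s => p s • B (IccExtend hT v s - IccExtend hT w s)) t := by
      rw [hΦ_apply, hΦ_apply, hlin]
      abel
    rw [dist_eq_norm, hsub]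
    refine (hS.norm_duhamel_smul_apply_le hp t.2 (C := dist v w) (fun s _ => ?_)
      dist_nonneg).trans ?_
    · rw [← dist_eq_norm]
      exact ContinuousMap.dist_apply_le_dist _
    · gcongr
      simpa using hB
  refine ⟨IccExtend hT (hΦ.fixedPoint), (hext _).continuousOn, fun t ht => ?_⟩
  have hfix := hΦ.fixedPoint_isFixedPt
  have := congrArg (fun v : C(Icc (0 : ℝ) T, X) => v ⟨t, ht⟩) hfix.eq
  rw [IccExtend_of_mem hT _ ht]
  exact this.symm

/-- `u` is a mild solution of `u' = G u - p(t) B u` on `[0, T]` with `u(0) = u₀`, where `G`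
generates `S`. -/
def IsBilinearMild (S : ℝ → X →L[𝕜] X) (B : X →L[𝕜] X) (p : ℝ → 𝕜) (T : ℝ) (u₀ : X) (u : ℝ → X) :
    Prop :=
  ContinuousOn u (Icc 0 T) ∧
    ∀ t ∈ Icc 0 T, u t = S t u₀ - duhamel S (fun s => p s • B (u s)) t

theorem IsBilinearMild.apply_zero (hS : IsContractionSemigroup S) (hT : 0 ≤ T) {u₀ : X} {u : ℝ → X}
    (h : IsBilinearMild S B p T u₀ u) : u 0 = u₀ := by
  rw [h.2 0 ⟨le_rfl, hT⟩, hS.zero_apply, duhamel, intervalIntegral.integral_same, sub_zero]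

theorem IsBilinearMild.congr {u₀ : X} {u w : ℝ → X} {q : ℝ → 𝕜}
    (h : IsBilinearMild S B p T u₀ u) (hpq : ∀ s ∈ Ioo 0 T, q s = p s)
    (huw : ∀ s ∈ Icc 0 T, w s = u s) : IsBilinearMild S B q T u₀ w := by
  refine ⟨h.1.congr huw, fun t ht => ?_⟩
  rw [huw t ht, h.2 t ht]
  congr 1
  refine duhamel_congr ht.1 fun s hs => ?_
  rw [hpq s ⟨hs.1, hs.2.trans_le ht.2⟩, huw s ⟨hs.1.le, hs.2.le.trans ht.2⟩]

theorem IsBilinearMild.concat [CompleteSpace X] (hS : IsContractionSemigroup S) {a b : ℝ}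
    (ha : 0 ≤ a) (hb : 0 ≤ b) (hp : IntervalIntegrable p volume 0 (a + b)) {u₀ : X} {u : ℝ → X}
    (h₁ : IsBilinearMild S B p a u₀ u)
    (h₂ : IsBilinearMild S B (fun s => p (s + a)) b (u a) fun s => u (s + a)) :
    IsBilinearMild S B p (a + b) u₀ u := by
  have hcont : ContinuousOn u (Icc 0 (a + b)) := by
    have h2 : ContinuousOn u (Icc a (a + b)) := by
      have h := h₂.1.comp (f := fun s => s - a) (s := Icc a (a + b)) (by fun_prop) fun s hs =>
        ⟨sub_nonneg.2 hs.1, by linarith [hs.2]⟩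
      exact h.congr fun s _ => by simp
    rw [← Icc_union_Icc_eq_Icc ha (by linarith : a ≤ a + b)]
    exact h₁.1.union_of_isClosed h2 isClosed_Icc isClosed_Icc
  refine ⟨hcont, fun t ht => ?_⟩
  rcases le_total t a with hta | hta
  · exact h₁.2 t ⟨ht.1, hta⟩
  · obtain ⟨r, rfl⟩ : ∃ r, t = a + r := ⟨t - a, by ring⟩
    have hr : 0 ≤ r := by linarith
    have h3 := h₂.2 r ⟨hr, by linarith [ht.2]⟩
    simp only at h3
    rw [add_comm r a] at h3
    rw [h3, h₁.2 a ⟨ha, le_rfl⟩, hS.duhamel_add ha hr (intervalIntegrable_smul_apply ht.1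
      (intervalIntegrable_of_mem_Icc hp ht) (hcont.mono (Icc_subset_Icc le_rfl ht.2))),
      map_sub, add_comm a r, hS.add_apply r a hr ha]
    abel

/-- Write `u = φ + v`. At time `T` the linear terms of `v` cancel by `hsteer`, leaving the integral
of `p B v`; its factor `κ` multiplies the supremum bound for `v`, which makes the final error
quadratic. -/
theorem IsContractionSemigroup.exists_isBilinearMild_of_steers [CompleteSpace X]
    (hS : IsContractionSemigroup S) {φ : X} (hφ : ∀ t, S t φ = φ) (hT : 0 ≤ T)
    (hp : IntervalIntegrable p volume 0 T) (hB : ‖B‖ * ∫ s in (0 : ℝ)..T, ‖p s‖ ≤ 1 / 2) {v₀ : X}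
    (hsteer : duhamel S (fun s => p s • B φ) T = S T v₀) :
    ∃ u : ℝ → X, IsBilinearMild S B p T (φ + v₀) u ∧
      (∀ t ∈ Icc 0 T, ‖u t - φ‖ ≤ 2 * (‖v₀‖ + (‖B‖ * ∫ s in (0 : ℝ)..T, ‖p s‖) * ‖φ‖)) ∧
      ‖u T - φ‖ ≤ (‖B‖ * ∫ s in (0 : ℝ)..T, ‖p s‖) *
        (2 * (‖v₀‖ + (‖B‖ * ∫ s in (0 : ℝ)..T, ‖p s‖) * ‖φ‖)) := by
  set κ := ‖B‖ * ∫ s in (0 : ℝ)..T, ‖p s‖ with hκ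
  have hκ0 : 0 ≤ κ := mul_nonneg (norm_nonneg _)
    (intervalIntegral.integral_nonneg hT fun _ _ => norm_nonneg _)
  have hpn : IntervalIntegrable (fun s => -p s) volume 0 T := hp.neg
  have hneg : ∀ (w : ℝ → X) t, duhamel S (fun s => -p s • B (w s)) t =
      -duhamel S (fun s => p s • B (w s)) t := by
    intro w t
    simp only [duhamel, neg_smul, map_neg, intervalIntegral.integral_neg]
  have hφint : IntervalIntegrable (fun s => p s • B φ) volume 0 T :=
    intervalIntegrable_smul_apply (u := fun _ => φ) hT hp continuousOn_const
  -- Applied to `-p`, since the fixed-point equation carries a plus sign.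
  obtain ⟨v, hv, hv'⟩ := hS.exists_continuousOn_eq_add_duhamel (p := fun s => -p s) (B := B) hT hpn
    (by simpa [norm_neg] using hB)
    (g := fun t => S t v₀ - duhamel S (fun s => p s • B φ) t)
    ((hS.continuous_apply v₀).continuousOn.sub (hS.continuousOn_duhamel hT hφint))
  simp only [hneg] at hv'
  have hbound : ∀ t ∈ Icc 0 T, ‖v t‖ ≤ 2 * (‖v₀‖ + κ * ‖φ‖) := by
    -- At a maximum of `‖v‖` the term `κ‖v t₀‖` is absorbed using `κ ≤ 1/2`, so no Grönwall argument
    -- is needed.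
    obtain ⟨t₀, ht₀, hmax⟩ := isCompact_Icc.exists_isMaxOn (nonempty_Icc.2 hT) hv.norm
    have hle : ‖v t₀‖ ≤ ‖v₀‖ + κ * ‖φ‖ + κ * ‖v t₀‖ := by
      have h1 := hS.norm_duhamel_smul_apply_le (B := B) hp ht₀ (u := fun _ => φ) (C := ‖φ‖)
        (fun _ _ => le_rfl) (norm_nonneg _)
      have h2 := hS.norm_duhamel_smul_apply_le (B := B) hp ht₀ (u := v) (C := ‖v t₀‖)
        (fun s hs => hmax ⟨hs.1.le, hs.2.le.trans ht₀.2⟩) (norm_nonneg _)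
      calc ‖v t₀‖ = ‖S t₀ v₀ - duhamel S (fun s => p s • B φ) t₀ +
            -duhamel S (fun s => p s • B (v s)) t₀‖ := by rw [← hv' t₀ ht₀]
        _ ≤ ‖S t₀ v₀‖ + ‖duhamel S (fun s => p s • B φ) t₀‖ +
            ‖duhamel S (fun s => p s • B (v s)) t₀‖ := by
          refine (norm_add_le _ _).trans ?_
          rw [norm_neg]
          gcongr
          exact norm_sub_le _ _
        _ ≤ _ := by
          gcongr
          exact hS.norm_apply_le _ _
    intro t ht
    have hm : ‖v t‖ ≤ ‖v t₀‖ := hmax ht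
    have : κ * ‖v t₀‖ ≤ 1 / 2 * ‖v t₀‖ := by gcongr
    linarith
  refine ⟨fun t => φ + v t, ⟨continuousOn_const.add hv, fun t ht => ?_⟩, fun t ht => ?_, ?_⟩
  · have hpt := intervalIntegrable_of_mem_Icc hp ht
    have : duhamel S (fun s => p s • B (φ + v s)) t =
        duhamel S (fun s => p s • B φ) t + duhamel S (fun s => p s • B (v s)) t := by
      rw [← hS.duhamel_add_fun (intervalIntegrable_of_mem_Icc hφint ht)
        (intervalIntegrable_smul_apply ht.1 hpt (hv.mono (Icc_subset_Icc le_rfl ht.2)))]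
      simp only [map_add, smul_add]
    change φ + v t = _
    rw [this, hv' t ht, map_add, hφ]
    abel
  · simpa using hbound t ht
  · have hT' : T ∈ Icc 0 T := ⟨hT, le_rfl⟩
    rw [add_sub_cancel_left, hv' T hT', hsteer, sub_self, zero_add, norm_neg]
    exact hS.norm_duhamel_smul_apply_le hp hT'
      (fun s hs => hbound s ⟨hs.1.le, hs.2.le⟩) (by positivity)

end MildSolution

/-! ### Gluing functions along a partition accumulating at `T`. -/

section Glue

variable {E : Type*} {τ : ℕ → ℝ} {T : ℝ}

/-- The function equal to `f n (t - τ n)` for `τ n ≤ t < τ (n + 1)`. -/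
noncomputable def glue (τ : ℕ → ℝ) (f : ℕ → ℝ → E) (t : ℝ) : E :=
  f (sInf {n | t < τ (n + 1)}) (t - τ (sInf {n | t < τ (n + 1)}))

theorem glue_apply (hτ : Monotone τ) (f : ℕ → ℝ → E) {n : ℕ} {t : ℝ}
    (ht : t ∈ Ico (τ n) (τ (n + 1))) : glue τ f t = f n (t - τ n) := by
  have h : sInf {n | t < τ (n + 1)} = n := by
    refine le_antisymm (Nat.sInf_le ht.2) (le_csInf ⟨n, ht.2⟩ fun m hm => ?_)
    by_contra! hlt
    exact absurd (hm.trans_le (hτ hlt)) (not_lt.2 ht.1)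
  rw [glue, h]

theorem exists_mem_Ico_of_tendsto (h0 : τ 0 = 0) (hlim : Tendsto τ atTop (𝓝 T)) {t : ℝ}
    (ht : t ∈ Ico 0 T) : ∃ n, t ∈ Ico (τ n) (τ (n + 1)) := by
  classical
  have hex : ∃ n, t < τ n := (hlim.eventually (lt_mem_nhds ht.2)).exists
  have hpos : Nat.find hex ≠ 0 := fun h => by
    have := Nat.find_spec hex
    rw [h, h0] at this
    exact absurd this (not_lt.2 ht.1)
  obtain ⟨n, hn⟩ := Nat.exists_eq_succ_of_ne_zero hpos
  refine ⟨n, not_lt.1 (Nat.find_min hex (m := n) (by omega)), ?_⟩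
  have := Nat.find_spec hex
  rwa [hn] at this

variable [NormedAddCommGroup E]

theorem measurePreserving_sub_restrict_Ioo (a b : ℝ) :
    MeasurePreserving (fun t : ℝ => t - a) (volume.restrict (Ioo a b))
      (volume.restrict (Ioo 0 (b - a))) := by
  have h := (measurePreserving_sub_right volume a).restrict_preimage
    (measurableSet_Ioo (a := 0) (b := b - a))
  simpa using h

theorem memLp_glue {f : ℕ → ℝ → E} (hτ : Monotone τ) (h0 : τ 0 = 0)
    (hlim : Tendsto τ atTop (𝓝 T))
    (hf : ∀ n, MemLp (f n) 2 (volume.restrict (Ioo 0 (τ (n + 1) - τ n))))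
    (hsum : Summable fun n => ∫ s in Ioo 0 (τ (n + 1) - τ n), ‖f n s‖ ^ 2) :
    MemLp (glue τ f) 2 (volume.restrict (Ioo 0 T)) := by
  have hpiece : ∀ n, MemLp (glue τ f) 2 (volume.restrict (Ico (τ n) (τ (n + 1)))) := by
    intro n
    have h := (hf n).comp_measurePreserving (measurePreserving_sub_restrict_Ioo (τ n) (τ (n + 1)))
    rw [Measure.restrict_congr_set Ioo_ae_eq_Ico] at h
    refine (memLp_congr_ae ?_).1 h
    filter_upwards [ae_restrict_mem measurableSet_Ico] with t ht
    exact (glue_apply hτ f ht).symm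
  have hint : ∀ n, ∫ s in Ico (τ n) (τ (n + 1)), ‖glue τ f s‖ ^ 2 =
      ∫ s in Ioo 0 (τ (n + 1) - τ n), ‖f n s‖ ^ 2 := by
    intro n
    rw [← (measurePreserving_sub_restrict_Ioo (τ n) (τ (n + 1))).integral_comp
      (measurableEmbedding_subRight (τ n)) (fun s => ‖f n s‖ ^ 2),
      ← integral_Ico_eq_integral_Ioo]
    refine setIntegral_congr_fun measurableSet_Ico fun t ht => ?_
    simp only [glue_apply hτ f ht]
  have hsub : Ioo 0 T ⊆ ⋃ n, Ico (τ n) (τ (n + 1)) := fun t ht =>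
    mem_iUnion.2 (exists_mem_Ico_of_tendsto h0 hlim ⟨ht.1.le, ht.2⟩)
  have hmeas : AEStronglyMeasurable (glue τ f) (volume.restrict (⋃ n, Ico (τ n) (τ (n + 1)))) :=
    AEStronglyMeasurable.iUnion fun n => (hpiece n).1
  have hL : MemLp (glue τ f) 2 (volume.restrict (⋃ n, Ico (τ n) (τ (n + 1)))) := by
    rw [memLp_two_iff_integrable_sq_norm hmeas]
    refine integrableOn_iUnion_of_summable_integral_norm
      (fun n => (memLp_two_iff_integrable_sq_norm (hpiece n).1).1 (hpiece n)) ?_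
    simpa [hint] using hsum
  exact hL.mono_measure (Measure.restrict_mono hsub le_rfl)

end Glue

/-! ### Concatenating infinitely many solutions, and prepending free evolution. -/

section MildSolution

variable {𝕜 X : Type*} [RCLike 𝕜] [NormedAddCommGroup X] [InnerProductSpace 𝕜 X]
  [NormedSpace ℝ X] [CompleteSpace X] {S : ℝ → X →L[𝕜] X} {B : X →L[𝕜] X} {T : ℝ}

theorem IsControl.intervalIntegrable {p : ℝ → 𝕜} (hT : 0 ≤ T) (hp : IsControl p T) :
    IntervalIntegrable p volume 0 T :=
  (intervalIntegrable_iff_integrableOn_Ioo_of_le hT).2 (MemLp.integrable one_le_two hp)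

/-- Finite concatenation settles every `[0, τ n]`. The bounds `δ n → 0` give continuity of the glued
trajectory at `T`, with value `φ`, and square-summability puts the control in `L²` up to `T`. -/
theorem IsContractionSemigroup.exists_isBilinearMild_of_seq (hS : IsContractionSemigroup S)
    {τ : ℕ → ℝ} (hτ : StrictMono τ) (h0 : τ 0 = 0) (hlim : Tendsto τ atTop (𝓝 T))
    {x : ℕ → X} {p : ℕ → ℝ → 𝕜} {u : ℕ → ℝ → X}
    (hu : ∀ n, IsBilinearMild S B (p n) (τ (n + 1) - τ n) (x n) (u n))
    (hx : ∀ n, u n (τ (n + 1) - τ n) = x (n + 1))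
    {δ : ℕ → ℝ} (hδ : Tendsto δ atTop (𝓝 0)) {φ : X}
    (huδ : ∀ n, ∀ t ∈ Icc 0 (τ (n + 1) - τ n), ‖u n t - φ‖ ≤ δ n)
    (hp : ∀ n, IsControl (p n) (τ (n + 1) - τ n))
    (hsum : Summable fun n => ∫ s in Ioo 0 (τ (n + 1) - τ n), ‖p n s‖ ^ 2) :
    ∃ q : ℝ → 𝕜, IsControl q T ∧ ∃ w : ℝ → X, IsBilinearMild S B q T (x 0) w ∧ w T = φ := by
  have hmono := hτ.monotone
  have hltT : ∀ n, τ n < T := fun n =>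
    (hτ (Nat.lt_succ_self n)).trans_le (hmono.ge_of_tendsto hlim _)
  have hT : 0 ≤ T := h0 ▸ (hltT 0).le
  have hτ0 : ∀ n, 0 ≤ τ n := fun n => h0 ▸ hmono (Nat.zero_le n)
  have hpos : ∀ n, 0 < τ (n + 1) - τ n := fun n => sub_pos.2 (hτ (Nat.lt_succ_self n))
  let q := glue τ p
  have hq : IsControl q T := memLp_glue hmono h0 hlim hp hsum
  have hqint := hq.intervalIntegrable hT
  let w : ℝ → X := fun t => if t < T then glue τ u t else φ
  have hw : ∀ n, ∀ t ∈ Ico (τ n) (τ (n + 1)), w t = u n (t - τ n) := fun n t ht => by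
    simp only [w, if_pos (ht.2.trans (hltT _)), glue_apply hmono u ht]
  have hwT : w T = φ := if_neg (lt_irrefl T)
  have hwτ : ∀ n, w (τ n) = x n := fun n => by
    rw [hw n _ ⟨le_rfl, hτ (Nat.lt_succ_self n)⟩, sub_self, (hu n).apply_zero hS (hpos n).le]
  have hmild : ∀ n, IsBilinearMild S B q (τ n) (x 0) w := by
    intro n
    induction n with
    | zero =>
      rw [h0]
      refine ⟨by simp, fun t ht => ?_⟩
      obtain rfl : t = 0 := le_antisymm ht.2 ht.1
      have := hwτ 0
      rw [h0] at this
      rw [this, hS.zero_apply, duhamel, intervalIntegral.integral_same, sub_zero]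
    | succ n ih =>
      have hn : τ n + (τ (n + 1) - τ n) = τ (n + 1) := by ring
      rw [← hn]
      refine ih.concat hS (hτ0 n) (hpos n).le ?_ ?_
      · rw [hn]
        exact intervalIntegrable_of_mem_Icc hqint ⟨hτ0 _, (hltT _).le⟩
      · rw [hwτ]
        refine (hu n).congr (fun s hs => ?_) fun s hs => ?_
        · have := glue_apply hmono p (n := n) (t := s + τ n) ⟨by linarith [hs.1], by linarith [hs.2]⟩
          simpa using this
        · rcases hs.2.lt_or_eq with h | h
          · have := hw n (s + τ n) ⟨by linarith [hs.1], by linarith⟩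
            simpa using this
          · rw [h, hx, sub_add_cancel, hwτ]
  have hcontw : ContinuousOn w (Icc 0 T) := by
    intro t ht
    rcases ht.2.lt_or_eq with hlt | rfl
    · obtain ⟨n, hn⟩ := exists_mem_Ico_of_tendsto h0 hlim ⟨ht.1, hlt⟩
      refine ((hmild (n + 1)).1 t ⟨ht.1, hn.2.le⟩).mono_of_mem_nhdsWithin ?_
      filter_upwards [self_mem_nhdsWithin, mem_nhdsWithin_of_mem_nhds (gt_mem_nhds hn.2)]
        with s hs hs'
      exact ⟨hs.1, le_of_lt hs'⟩
    · rw [ContinuousWithinAt, Metric.tendsto_nhds]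
      intro ε hε
      obtain ⟨N, hN⟩ := eventually_atTop.1 (hδ.eventually (gt_mem_nhds hε))
      filter_upwards [self_mem_nhdsWithin, mem_nhdsWithin_of_mem_nhds (lt_mem_nhds (hltT N))]
        with s hs hs'
      rcases hs.2.lt_or_eq with hlt | rfl
      · obtain ⟨n, hn⟩ := exists_mem_Ico_of_tendsto h0 hlim ⟨hs.1, hlt⟩
        have hNn : N ≤ n := by
          by_contra! h
          exact absurd (hs'.trans hn.2) (not_lt.2 (hmono h))
        rw [hwT, dist_eq_norm, hw n s hn]
        exact (huδ n _ ⟨sub_nonneg.2 hn.1, by linarith [hn.2]⟩).trans_lt (hN n hNn)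
      · simpa using hε
  refine ⟨q, hq, w, ⟨hcontw, fun t ht => ?_⟩, hwT⟩
  rcases ht.2.lt_or_eq with hlt | rfl
  · obtain ⟨n, hn⟩ := exists_mem_Ico_of_tendsto h0 hlim ⟨ht.1, hlt⟩
    exact (hmild (n + 1)).2 t ⟨ht.1, hn.2.le⟩
  -- At the final time both sides of the integral equation are continuous and agree along `τ n`.
  · have hrhs : ContinuousOn (fun t => S t (x 0) - duhamel S (fun s => q s • B (w s)) t)
        (Icc 0 t) :=
      (hS.continuous_apply _).continuousOn.sub
        (hS.continuousOn_duhamel hT (intervalIntegrable_smul_apply hT hqint hcontw))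
    have hτt : Tendsto τ atTop (𝓝[Icc 0 t] t) :=
      tendsto_nhdsWithin_iff.2 ⟨hlim, Eventually.of_forall fun n => ⟨hτ0 n, (hltT n).le⟩⟩
    refine tendsto_nhds_unique ((hcontw t ht).tendsto.comp hτt) ?_
    refine ((hrhs t ht).tendsto.comp hτt).congr fun n => ?_
    exact ((hmild n).2 (τ n) ⟨hτ0 n, le_rfl⟩).symm

/-- Use zero control on `[0, a]`, then the given control shifted by `a`. -/
theorem IsContractionSemigroup.exists_isBilinearMild_of_free_evolution
    (hS : IsContractionSemigroup S) {a : ℝ} (ha : 0 ≤ a) (hT : 0 ≤ T) {u₀ : X} {p : ℝ → 𝕜}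
    (hp : IsControl p T) {u : ℝ → X} (hu : IsBilinearMild S B p T (S a u₀) u) :
    ∃ q : ℝ → 𝕜, IsControl q (a + T) ∧
      ∃ w : ℝ → X, IsBilinearMild S B q (a + T) u₀ w ∧ w (a + T) = u T := by
  let q : ℝ → 𝕜 := (Ioo a (a + T)).indicator fun t => p (t - a)
  let w : ℝ → X := fun t => if t < a then S t u₀ else u (t - a)
  have hq : IsControl q (a + T) := by
    have h := MemLp.comp_measurePreserving hp (by
      simpa using measurePreserving_sub_restrict_Ioo a (a + T) :
        MeasurePreserving (fun t : ℝ => t - a) (volume.restrict (Ioo a (a + T)))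
          (volume.restrict (Ioo 0 T)))
    exact ((memLp_indicator_iff_restrict measurableSet_Ioo).2 h).restrict _
  refine ⟨q, hq, w, ?_, ?_⟩
  · have hu0 := hu.apply_zero hS hT
    have hwa : ∀ t ∈ Icc 0 a, w t = S t u₀ := fun t ht => by
      rcases ht.2.lt_or_eq with h | rfl
      · exact if_pos h
      · simp only [w, lt_irrefl, if_false, sub_self, hu0]
    refine IsBilinearMild.concat hS ha hT (hq.intervalIntegrable (by positivity)) ?_ ?_
    · refine ⟨(hS.continuous_apply u₀).continuousOn.congr hwa, fun t ht => ?_⟩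
      have hz : duhamel S (fun s => q s • B (w s)) t = duhamel S (fun _ => 0) t := by
        refine duhamel_congr ht.1 fun s hs => ?_
        have : q s = 0 := indicator_of_notMem (fun h => by linarith [h.1, hs.2, ht.2]) _
        rw [this, zero_smul]
      rw [hwa t ht, hz]
      simp [duhamel]
    · rw [hwa a ⟨ha, le_rfl⟩]
      refine hu.congr (fun s hs => ?_) fun s hs => ?_
      · have h : s + a ∈ Ioo a (a + T) := ⟨by linarith [hs.1], by linarith [hs.2]⟩
        simp only [q, indicator_of_mem h, add_sub_cancel_right]
      · simp only [w, if_neg (not_lt.2 (by linarith [hs.1] : a ≤ s + a)), add_sub_cancel_right]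
  · simp only [w, if_neg (not_lt.2 (by linarith : a ≤ a + T)), add_sub_cancel_left]

end MildSolution

/-! ### Local exact steering to `φ` by iterated linear null control. -/

section LocalControl

variable {𝕜 X : Type*} [RCLike 𝕜] [NormedAddCommGroup X] [InnerProductSpace 𝕜 X]
  [NormedSpace ℝ X] {S : ℝ → X →L[𝕜] X} {B : X →L[𝕜] X}

/-- The control `p` steers `v` to zero in time `T` along the linear system
`y' = G y - p(t) b`, where `G` generates `S`, with `L¹` and `L²` norms at most `c`. -/
structure IsNullControlWithBound (S : ℝ → X →L[𝕜] X) (b : X) (T c : ℝ) (v : X) (p : ℝ → 𝕜) :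
    Prop where
  isControl : IsControl p T
  duhamel_eq : duhamel S (fun s => p s • b) T = S T v
  integral_norm_le : ∫ s in (0 : ℝ)..T, ‖p s‖ ≤ c
  integral_norm_sq_le : ∫ s in Ioo 0 T, ‖p s‖ ^ 2 ≤ c ^ 2

/-- Comparison with a geometric series through `e^{-x} ≤ 1/x`. -/
theorem summable_exp_neg_mul_pow {c : ℝ} (hc : 0 < c) :
    Summable fun n : ℕ => Real.exp (-(c * (4 / 3 : ℝ) ^ n)) := by
  refine Summable.of_nonneg_of_le (fun n => (Real.exp_pos _).le) (fun n => ?_)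
    ((summable_geometric_of_lt_one (r := (3 / 4 : ℝ)) (by norm_num) (by norm_num)).mul_left c⁻¹)
  have hpos : 0 < c * (4 / 3 : ℝ) ^ n := by positivity
  have h34 : (3 / 4 : ℝ) ^ n = ((4 / 3 : ℝ) ^ n)⁻¹ := by
    rw [← inv_pow]
    norm_num
  rw [Real.exp_neg, h34, ← mul_inv]
  exact inv_anti₀ hpos (by linarith [Real.add_one_le_exp (c * (4 / 3 : ℝ) ^ n)])

variable [CompleteSpace X]

theorem IsContractionSemigroup.exists_isBilinearMild_quadratic (hS : IsContractionSemigroup S)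
    {φ : X} (hφ : ∀ t, S t φ = φ) {T : ℝ} (hT : 0 ≤ T) {N b ε : ℝ} (hN : 1 ≤ N) (hb : 1 ≤ b)
    (hBb : ‖B‖ ≤ b) (hBφ : ‖B‖ * ‖φ‖ ≤ b) (hsmall : b * (N * ε) ≤ 1 / 2)
    {v : X} (hv : ‖v‖ ≤ ε) {p : ℝ → 𝕜} (hp : IsNullControlWithBound S (B φ) T (N * ‖v‖) v p) :
    ∃ u : ℝ → X, IsBilinearMild S B p T (φ + v) u ∧
      (∀ t ∈ Icc 0 T, ‖u t - φ‖ ≤ 4 * b * (N * ε)) ∧ ‖u T - φ‖ ≤ 4 * b ^ 2 * (N * ε) ^ 2 := by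
  have hε : 0 ≤ ε := (norm_nonneg v).trans hv
  have hI0 : 0 ≤ ∫ s in (0 : ℝ)..T, ‖p s‖ :=
    intervalIntegral.integral_nonneg hT fun _ _ => norm_nonneg _
  have hI : ∫ s in (0 : ℝ)..T, ‖p s‖ ≤ N * ε := hp.integral_norm_le.trans (by gcongr)
  have hκ : ‖B‖ * ∫ s in (0 : ℝ)..T, ‖p s‖ ≤ b * (N * ε) := by gcongr
  obtain ⟨u, hu, hu1, hu2⟩ := hS.exists_isBilinearMild_of_steers (B := B) hφ hT
    (hp.isControl.intervalIntegrable hT) (hκ.trans hsmall) hp.duhamel_eq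
  have hNε : 0 ≤ N * ε := by positivity
  have hbd : 2 * (‖v‖ + (‖B‖ * ∫ s in (0 : ℝ)..T, ‖p s‖) * ‖φ‖) ≤ 4 * b * (N * ε) := by
    have h1 : (‖B‖ * ∫ s in (0 : ℝ)..T, ‖p s‖) * ‖φ‖ ≤ b * (N * ε) :=
      calc (‖B‖ * ∫ s in (0 : ℝ)..T, ‖p s‖) * ‖φ‖ =
            (‖B‖ * ‖φ‖) * ∫ s in (0 : ℝ)..T, ‖p s‖ := by ring
        _ ≤ b * (N * ε) := by gcongr
    have h2 : ‖v‖ ≤ b * (N * ε) := by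
      calc ‖v‖ ≤ 1 * (1 * ε) := by linarith
        _ ≤ b * (N * ε) := by gcongr
    linarith
  refine ⟨u, hu, fun t ht => (hu1 t ht).trans hbd, hu2.trans ?_⟩
  calc _ ≤ (b * (N * ε)) * (4 * b * (N * ε)) := by gcongr
    _ = 4 * b ^ 2 * (N * ε) ^ 2 := by ring

theorem IsContractionSemigroup.exists_local_steering (hS : IsContractionSemigroup S)
    {φ : X} (hφ : ∀ t, S t φ = φ) {a T₁ : ℝ} (ha : 0 < a) (hT₁ : 0 < T₁)
    (hnull : ∀ τ, 0 < τ → τ ≤ T₁ → ∀ v : X, ∃ p : ℝ → 𝕜,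
      IsNullControlWithBound S (B φ) τ (Real.exp (a / τ) * ‖v‖) v p) :
    ∃ T ρ : ℝ, 0 < T ∧ 0 < ρ ∧ ∀ v : X, ‖v‖ ≤ ρ → ∃ p : ℝ → 𝕜, IsControl p T ∧
      ∃ u : ℝ → X, IsBilinearMild S B p T (φ + v) u ∧ u T = φ := by
  set b : ℝ := 1 + ‖B‖ * (1 + ‖φ‖) with hb
  have hb1 : 1 ≤ b := by
    have : 0 ≤ ‖B‖ * (1 + ‖φ‖) := by positivity
    linarith
  have hBb : ‖B‖ ≤ b := by
    have : 0 ≤ ‖B‖ * ‖φ‖ := by positivity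
    linarith
  have hBφ : ‖B‖ * ‖φ‖ ≤ b := by linarith [norm_nonneg B]
  set L := Real.log (4 * b ^ 2) with hL
  have hb2 : (0 : ℝ) < 4 * b ^ 2 := by positivity
  have hexpL : Real.exp L = 4 * b ^ 2 := Real.exp_log hb2
  have hL0 : 0 < L := Real.log_pos (by nlinarith)
  set α := a / T₁ with hα
  have hα0 : 0 < α := div_pos ha hT₁
  -- Squaring and dividing by the growth factor `4/3` must absorb `4b² = e^L` and the squared cost:
  -- `L - 2(M - α)g ≤ -(4/3)Mg`. This `M` reduces it to `L ≤ Lg`, true as `g ≥ 1`.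
  set M := 3 / 2 * (L + 2 * α) with hM
  let g : ℕ → ℝ := fun n => (4 / 3 : ℝ) ^ n
  have hg1 : ∀ n, 1 ≤ g n := fun n => one_le_pow₀ (by norm_num)
  have hgs : ∀ n, g (n + 1) = 4 / 3 * g n := fun n => pow_succ' _ _
  let N : ℕ → ℝ := fun n => Real.exp (α * g n)
  let ε : ℕ → ℝ := fun n => Real.exp (-(M * g n))
  have hNε : ∀ n, N n * ε n = Real.exp (-((3 / 2 * L + 2 * α) * g n)) := fun n => by
    simp only [N, ε]
    rw [← Real.exp_add]
    congr 1
    rw [hM]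
    ring
  have hsmall : ∀ n, b * (N n * ε n) ≤ 1 / 2 := fun n => by
    have h1 : N n * ε n ≤ Real.exp (-L) := by
      rw [hNε, Real.exp_le_exp]
      nlinarith [hg1 n]
    rw [Real.exp_neg, hexpL] at h1
    calc b * (N n * ε n) ≤ b * (4 * b ^ 2)⁻¹ := by gcongr
      _ = 1 / (4 * b) := by field_simp
      _ ≤ 1 / 2 := by
        rw [div_le_div_iff₀ (by positivity) (by norm_num)]
        linarith
  have hquad : ∀ n, 4 * b ^ 2 * (N n * ε n) ^ 2 ≤ ε (n + 1) := fun n => by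
    rw [← hexpL, hNε, ← Real.exp_nat_mul, ← Real.exp_add]
    simp only [ε]
    rw [Real.exp_le_exp, hgs, hM]
    push_cast
    nlinarith [hg1 n]
  -- The lengths shrink as `1/g n`, so the cost `exp(a / d n)` is exactly `N n`.
  let d : ℕ → ℝ := fun n => T₁ * (3 / 4 : ℝ) ^ n
  have hd0 : ∀ n, 0 < d n := fun n => by positivity
  have hd1 : ∀ n, d n ≤ T₁ := fun n =>
    mul_le_of_le_one_right hT₁.le (pow_le_one₀ (by norm_num) (by norm_num))
  have hNd : ∀ n, Real.exp (a / d n) = N n := fun n => by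
    have h34 : (3 / 4 : ℝ) ^ n = (g n)⁻¹ := by
      simp only [g]
      rw [← inv_pow]
      norm_num
    simp only [N, d]
    rw [h34, hα]
    congr 1
    have := hg1 n
    field_simp
  -- The smallness of `v` sits inside the existential so that `choose` yields total functions, with
  -- dummy values outside the ball.
  have step : ∀ (n : ℕ) (v : X), ∃ (p : ℝ → 𝕜) (u : ℝ → X), ‖v‖ ≤ ε n →
      IsControl p (d n) ∧ ∫ s in Ioo 0 (d n), ‖p s‖ ^ 2 ≤ (N n * ε n) ^ 2 ∧
      IsBilinearMild S B p (d n) (φ + v) u ∧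
      (∀ t ∈ Icc 0 (d n), ‖u t - φ‖ ≤ 4 * b * (N n * ε n)) ∧ ‖u (d n) - φ‖ ≤ ε (n + 1) := by
    intro n v
    by_cases hv : ‖v‖ ≤ ε n
    · obtain ⟨p, hp⟩ := hnull (d n) (hd0 n) (hd1 n) v
      rw [hNd] at hp
      have hN1 : 1 ≤ N n := Real.one_le_exp (mul_nonneg hα0.le (zero_le_one.trans (hg1 n)))
      obtain ⟨u, hu, hu1, hu2⟩ := hS.exists_isBilinearMild_quadratic hφ (hd0 n).le hN1 hb1 hBb hBφ
        (hsmall n) hv hp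
      exact ⟨p, u, fun _ => ⟨hp.isControl, hp.integral_norm_sq_le.trans (by gcongr), hu, hu1,
        hu2.trans (hquad n)⟩⟩
    · exact ⟨0, 0, fun h => absurd h hv⟩
  choose P U hPU using step
  let τ : ℕ → ℝ := fun n => ∑ k ∈ Finset.range n, d k
  have hτd : ∀ n, τ (n + 1) - τ n = d n := fun n => by simp [τ, Finset.sum_range_succ]
  have hτ : StrictMono τ := strictMono_nat_of_lt_succ fun n => by linarith [hτd n, hd0 n]
  have hsumd : HasSum d (T₁ * 4) := by
    have h := (hasSum_geometric_of_lt_one (r := (3 / 4 : ℝ)) (by norm_num) (by norm_num)).mul_left T₁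
    convert! h using 2
    norm_num
  have hc : 0 < 3 / 2 * L + 2 * α := by positivity
  have hsumNε : Summable fun n => N n * ε n := by
    simp_rw [hNε]
    exact summable_exp_neg_mul_pow hc
  refine ⟨T₁ * 4, ε 0, by positivity, Real.exp_pos _, fun v₀ hv₀ => ?_⟩
  let v : ℕ → X := fun n => Nat.rec v₀ (fun n w => U n w (d n) - φ) n
  have hvs : ∀ n, v (n + 1) = U n (v n) (d n) - φ := fun n => rfl
  have hvε : ∀ n, ‖v n‖ ≤ ε n := by
    intro n
    induction n with
    | zero => exact hv₀
    | succ n ih =>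
      rw [hvs]
      exact (hPU n (v n) ih).2.2.2.2
  refine hS.exists_isBilinearMild_of_seq (x := fun n => φ + v n) (p := fun n => P n (v n))
    (u := fun n => U n (v n)) (δ := fun n => 4 * b * (N n * ε n)) hτ (by simp [τ])
    hsumd.tendsto_sum_nat ?_ ?_ ?_ ?_ ?_ ?_
  · intro n
    rw [hτd]
    exact (hPU n (v n) (hvε n)).2.2.1
  · intro n
    rw [hτd, hvs, add_sub_cancel]
  · simpa using hsumNε.tendsto_atTop_zero.const_mul (4 * b)
  · intro n
    rw [hτd]
    exact (hPU n (v n) (hvε n)).2.2.2.1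
  · intro n
    rw [hτd]
    exact (hPU n (v n) (hvε n)).1
  · simp_rw [hτd]
    -- Since `N n * ε n ≤ 1`, its square is dominated by the summable sequence itself.
    refine Summable.of_nonneg_of_le (fun n => by positivity)
      (fun n => (hPU n (v n) (hvε n)).2.1.trans ?_) hsumNε
    rw [sq]
    refine mul_le_of_le_one_left (by positivity) ?_
    rw [hNε, Real.exp_le_one_iff, neg_nonpos]
    exact mul_nonneg hc.le (zero_le_one.trans (hg1 n))

end LocalControl

/-! ### From the original system to the rescaled one. -/

section Reduction

variable {𝕜 X : Type*} [RCLike 𝕜] [NormedAddCommGroup X] [InnerProductSpace 𝕜 X]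

/-- Cauchy–Schwarz, with the factor `T^{1/2}` at most 1. -/
theorem IsControl.integral_norm_le {p : ℝ → 𝕜} {T c : ℝ} (hp : IsControl p T) (hT0 : 0 ≤ T)
    (hT : T ≤ 1) (hc : 0 ≤ c) (h : controlNorm p T ≤ ENNReal.ofReal c) :
    ∫ s in (0 : ℝ)..T, ‖p s‖ ≤ c := by
  have h1 : eLpNorm p 1 (volume.restrict (Ioo 0 T)) ≤ ENNReal.ofReal c := by
    refine (eLpNorm_le_eLpNorm_mul_rpow_measure_univ (p := 1) (q := 2) one_le_two hp.1).trans ?_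
    refine (mul_le_of_le_one_right' (ENNReal.rpow_le_one ?_ (by norm_num))).trans h
    simpa using hT
  rw [eLpNorm_one_eq_lintegral_enorm,
    ← ofReal_integral_norm_eq_lintegral_enorm (MemLp.integrable one_le_two hp),
    ENNReal.ofReal_le_ofReal_iff hc] at h1
  rwa [intervalIntegral.integral_of_le hT0, integral_Ioc_eq_integral_Ioo]

theorem IsControl.integral_norm_sq_le {p : ℝ → 𝕜} {T c : ℝ} (hp : IsControl p T) (hc : 0 ≤ c)
    (h : controlNorm p T ≤ ENNReal.ofReal c) : ∫ s in Ioo 0 T, ‖p s‖ ^ 2 ≤ c ^ 2 := by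
  have hI : 0 ≤ ∫ s in Ioo 0 T, ‖p s‖ ^ 2 := integral_nonneg fun _ => by positivity
  have h1 := MemLp.eLpNorm_eq_integral_rpow_norm two_ne_zero ENNReal.ofNat_ne_top hp
  rw [controlNorm, h1, ENNReal.ofReal_le_ofReal_iff hc] at h
  simp only [ENNReal.toReal_ofNat, Real.rpow_two] at h
  rw [← one_div, ← Real.sqrt_eq_rpow] at h
  exact (Real.sqrt_le_left hc).1 h

variable [CompleteSpace X] [NormedSpace ℝ X] {A : X →ₗ.[𝕜] X} {S : ℝ → X →L[𝕜] X} {lam : ℝ}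

omit [NormedSpace ℝ X] in
theorem semigroup_eq (hSA : ∀ t, 0 ≤ t → ∀ x, S t x =
      ((Real.exp (lam * t) : ℝ) : 𝕜) • semigroup A t x) {t : ℝ} (ht : 0 ≤ t) (x : X) :
    semigroup A t x = ((Real.exp (-(lam * t)) : ℝ) : 𝕜) • S t x := by
  rw [hSA t ht, smul_smul, ← RCLike.ofReal_mul, ← Real.exp_add, neg_add_cancel, Real.exp_zero,
    RCLike.ofReal_one, one_smul]

theorem smul_duhamel (hSA : ∀ t, 0 ≤ t → ∀ x, S t x =
      ((Real.exp (lam * t) : ℝ) : 𝕜) • semigroup A t x) {t : ℝ} (ht : 0 ≤ t) (f : ℝ → X) :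
    ((Real.exp (-(lam * t)) : ℝ) : 𝕜) • duhamel S f t =
      ∫ s in (0 : ℝ)..t, semigroup A (t - s) (((Real.exp (-(lam * s)) : ℝ) : 𝕜) • f s) := by
  rw [duhamel, ← intervalIntegral.integral_smul]
  refine intervalIntegral.integral_congr fun s hs => ?_
  rw [uIcc_of_le ht] at hs
  rw [semigroup_eq hSA (sub_nonneg.2 hs.2), map_smul, smul_smul, ← RCLike.ofReal_mul,
    ← Real.exp_add]
  congr 4
  ring

theorem IsBilinearMild.isMildSolution (hSA : ∀ t, 0 ≤ t → ∀ x, S t x =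
      ((Real.exp (lam * t) : ℝ) : 𝕜) • semigroup A t x) {B : X →L[𝕜] X} {p : ℝ → 𝕜} {T : ℝ}
    {u₀ : X} {u : ℝ → X} (hu : IsBilinearMild S B p T u₀ u) :
    IsMildSolution A B p 0 T u₀ fun t => ((Real.exp (-(lam * t)) : ℝ) : 𝕜) • u t := by
  refine ⟨ContinuousOn.smul (by fun_prop) hu.1, fun t ht => ?_⟩
  simp only
  rw [hu.2 t ht, smul_sub, ← semigroup_eq hSA ht.1, smul_duhamel hSA ht.1]
  congr 1
  refine intervalIntegral.integral_congr fun s _ => ?_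
  simp only [Pi.zero_apply, add_zero, map_smul]
  rw [smul_comm]

/-- Rescaling the state by `e^{λs}` rescales the control likewise, at a price of at most `e^λ` since
`T ≤ 1`. The scalar `k` undoes the normalisation to the unit sphere. -/
theorem SteersLinearToZero.isNullControlWithBound (hSA : ∀ t, 0 ≤ t → ∀ x, S t x =
      ((Real.exp (lam * t) : ℝ) : 𝕜) • semigroup A t x) (hlam : 0 ≤ lam) {B : X →L[𝕜] X}
    {p : ℝ → 𝕜} {φ : X} {T : ℝ} (hT0 : 0 ≤ T) (hT : T ≤ 1)
    {y₀ : X} (hp : SteersLinearToZero A B φ T y₀ p) {c : ℝ} (hc : 0 ≤ c)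
    (hpc : controlNorm p T ≤ ENNReal.ofReal c) (k : 𝕜) :
    IsNullControlWithBound S (B φ) T (‖k‖ * Real.exp lam * c) (k • y₀)
      (fun s => k * ((Real.exp (lam * s) : ℝ) : 𝕜) * p s) := by
  obtain ⟨hp, y, hy, hyT⟩ := hp
  have hle : ∀ᵐ s ∂(volume.restrict (Ioo 0 T)),
      ‖k * ((Real.exp (lam * s) : ℝ) : 𝕜) * p s‖ ≤ ‖k‖ * Real.exp lam * ‖p s‖ := by
    filter_upwards [ae_restrict_mem measurableSet_Ioo] with s hs
    rw [norm_mul, norm_mul, RCLike.norm_ofReal, abs_of_pos (Real.exp_pos _)]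
    gcongr
    nlinarith [hs.1, hs.2]
  have hcont : Continuous fun s : ℝ => k * ((Real.exp (lam * s) : ℝ) : 𝕜) := by fun_prop
  have hctrl : IsControl (fun s => k * ((Real.exp (lam * s) : ℝ) : 𝕜) * p s) T :=
    MemLp.of_le_mul hp (hcont.aestronglyMeasurable.mul hp.1) hle
  have hnorm : controlNorm (fun s => k * ((Real.exp (lam * s) : ℝ) : 𝕜) * p s) T ≤
      ENNReal.ofReal (‖k‖ * Real.exp lam * c) := by
    refine (eLpNorm_le_mul_eLpNorm_of_ae_le_mul hle 2).trans ?_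
    rw [ENNReal.ofReal_mul (p := ‖k‖ * Real.exp lam) (by positivity)]
    exact mul_le_mul_right hpc _
  refine ⟨hctrl, ?_, hctrl.integral_norm_le hT0 hT (by positivity) hnorm,
    hctrl.integral_norm_sq_le (by positivity) hnorm⟩
  have h := hy.2 T ⟨hT0, le_rfl⟩
  rw [hyT, eq_comm, sub_eq_zero] at h
  have h2 := smul_duhamel hSA hT0 fun s => (k * ((Real.exp (lam * s) : ℝ) : 𝕜) * p s) • B φ
  have h3 : ∫ s in (0 : ℝ)..T, semigroup A (T - s) (((Real.exp (-(lam * s)) : ℝ) : 𝕜) •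
      (k * ((Real.exp (lam * s) : ℝ) : 𝕜) * p s) • B φ) = k • semigroup A T y₀ := by
    rw [h, ← intervalIntegral.integral_smul]
    refine intervalIntegral.integral_congr fun s hs => ?_
    rw [uIcc_of_le hT0] at hs
    have he : ((Real.exp (-(lam * s)) : ℝ) : 𝕜) * ((Real.exp (lam * s) : ℝ) : 𝕜) = 1 := by
      rw [← RCLike.ofReal_mul, ← Real.exp_add, neg_add_cancel, Real.exp_zero, RCLike.ofReal_one]
    have he' : ((Real.exp (-(lam * s)) : ℝ) : 𝕜) * (k * ((Real.exp (lam * s) : ℝ) : 𝕜) * p s) =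
        k * p s := by linear_combination k * p s * he
    simp only [_root_.zero_apply, smul_zero, zero_add]
    rw [smul_smul, he', mul_smul, semigroup_eq hSA (sub_nonneg.2 hs.2),
      semigroup_eq hSA (sub_nonneg.2 hs.2), map_smul, smul_comm]
  rw [h3, semigroup_eq hSA hT0, smul_comm k] at h2
  have hne : ((Real.exp (-(lam * T)) : ℝ) : 𝕜) ≠ 0 := by exact_mod_cast (Real.exp_pos _).ne'
  rw [map_smul]
  exact smul_right_injective X hne h2

theorem exists_isNullControlWithBound
    (hSA : ∀ t, 0 ≤ t → ∀ x, S t x =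
      ((Real.exp (lam * t) : ℝ) : 𝕜) • semigroup A t x) (hlam : 0 ≤ lam) {B : X →L[𝕜] X}
    {φ : X} {T ν : ℝ} (hT0 : 0 < T) (hT : T ≤ 1)
    (hcost : controlCost A B φ T ≤ ENNReal.ofReal (Real.exp (ν / T))) (v : X) :
    ∃ p : ℝ → 𝕜, IsNullControlWithBound S (B φ) T (Real.exp ((ν + lam + 1) / T) * ‖v‖) v p := by
  by_cases hv : v = 0
  · refine ⟨0, ?_, ?_, ?_, ?_⟩
    · exact MemLp.zero
    all_goals simp [hv, duhamel]
  have hv0 : ‖v‖ ≠ 0 := norm_ne_zero_iff.2 hv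
  have hvk : ((‖v‖ : ℝ) : 𝕜) ≠ 0 := by exact_mod_cast hv0
  have hy : ‖((‖v‖ : ℝ) : 𝕜)⁻¹ • v‖ = 1 := by
    rw [norm_smul, norm_inv, RCLike.norm_ofReal, abs_norm, inv_mul_cancel₀ hv0]
  -- The infimum in the cost need not be attained, so a factor `e` is conceded; `T ≤ 1` lets the
  -- exponent `(ν + lam + 1) / T` absorb it together with `e^λ`.
  have hlt : (⨅ (p : ℝ → 𝕜) (_ : SteersLinearToZero A B φ T (((‖v‖ : ℝ) : 𝕜)⁻¹ • v) p),
      controlNorm p T) < ENNReal.ofReal (Real.exp 1 * Real.exp (ν / T)) := by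
    refine lt_of_le_of_lt ((le_iSup₂ (f := fun (y₀ : X) (_ : ‖y₀‖ = 1) =>
      ⨅ (p : ℝ → 𝕜) (_ : SteersLinearToZero A B φ T y₀ p), controlNorm p T) _ hy).trans hcost) ?_
    rw [ENNReal.ofReal_lt_ofReal_iff (by positivity)]
    have := Real.one_lt_exp_iff.2 (one_pos (α := ℝ))
    exact lt_mul_of_one_lt_left (Real.exp_pos _) this
  simp only [iInf_lt_iff] at hlt
  obtain ⟨p, hp, hpc⟩ := hlt
  have h := hp.isNullControlWithBound hSA hlam hT0.le hT (by positivity) hpc.le ((‖v‖ : ℝ) : 𝕜)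
  rw [smul_inv_smul₀ hvk, RCLike.norm_ofReal, abs_norm] at h
  have hle : ‖v‖ * Real.exp lam * (Real.exp 1 * Real.exp (ν / T)) ≤
      Real.exp ((ν + lam + 1) / T) * ‖v‖ := by
    have : Real.exp lam * (Real.exp 1 * Real.exp (ν / T)) ≤ Real.exp ((ν + lam + 1) / T) := by
      rw [← Real.exp_add, ← Real.exp_add, Real.exp_le_exp, add_div, add_div]
      have h1 : lam ≤ lam / T := le_div_self hlam hT0 hT
      have h2 : 1 ≤ 1 / T := (one_le_div hT0).2 hT
      linarith
    calc _ = (Real.exp lam * (Real.exp 1 * Real.exp (ν / T))) * ‖v‖ := by ring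
      _ ≤ _ := by gcongr
  exact ⟨_, h.isControl, h.duhamel_eq, h.integral_norm_le.trans hle,
    h.integral_norm_sq_le.trans (by gcongr)⟩

/-- The projection onto `V` is invariant under `S`, so projecting the null-control identity gives `P
x = (∫ p) P b`. The range of `P` is thus a line, and it contains `φ`. -/
theorem starProjection_eq_inner_smul (hS : IsContractionSemigroup S) {V : Submodule 𝕜 X}
    [V.HasOrthogonalProjection] (hPS : ∀ t x, V.starProjection (S t x) = V.starProjection x)
    {b : X} {T : ℝ} (hT : 0 ≤ T)
    (hnull : ∀ v : X, ∃ (p : ℝ → 𝕜) (c : ℝ), IsNullControlWithBound S b T c v p)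
    {φ : X} (hφV : φ ∈ V) (hφ1 : ‖φ‖ = 1) (x : X) :
    V.starProjection x = inner 𝕜 φ x • φ := by
  have hspan : ∀ x : X, ∃ k : 𝕜, V.starProjection x = k • V.starProjection b := by
    intro x
    obtain ⟨p, c, hp⟩ := hnull x
    refine ⟨∫ s in (0 : ℝ)..T, p s, ?_⟩
    have hint : IntervalIntegrable (fun s => p s • b) volume 0 T := by
      have := hp.isControl.intervalIntegrable hT
      exact this.smul_continuousOn continuousOn_const
    rw [← hPS T x, ← hp.duhamel_eq, duhamel,
      ← ContinuousLinearMap.intervalIntegral_comp_comm _ (hS.intervalIntegrable hint T)]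
    simp only [hPS, map_smul]
    rw [intervalIntegral.integral_smul_const]
  have hφP : V.starProjection φ = φ := Submodule.starProjection_eq_self_iff.2 hφV
  obtain ⟨k, hk⟩ := hspan φ
  obtain ⟨l, hl⟩ := hspan x
  have hk0 : k ≠ 0 := by
    rintro rfl
    rw [hφP, zero_smul] at hk
    simp [hk] at hφ1
  have hx : V.starProjection x = (l * k⁻¹) • φ := by
    rw [hl, ← hφP, hk, smul_smul, inv_mul_cancel_right₀ hk0]
  have hinner : inner 𝕜 φ x = l * k⁻¹ := by
    have h : inner 𝕜 (V.starProjection φ) x = inner 𝕜 φ (V.starProjection x) :=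
      Submodule.inner_starProjection_left_eq_right _ _ _
    rw [hφP, hx, inner_smul_right, inner_self_eq_norm_sq_to_K, hφ1] at h
    simpa using h
  rw [hx, hinner]

end Reduction

end BilinearControl

/-! ### Free evolution into the local steering ball. -/

theorem theorem1p3 {𝕜 X : Type*} [RCLike 𝕜] [NormedAddCommGroup X] [InnerProductSpace 𝕜 X]
    [NormedSpace ℝ X] [IsScalarTower ℝ 𝕜 X] [CompleteSpace X] [TopologicalSpace.SeparableSpace X]
    (A : X →ₗ.[𝕜] X) (hA : BilinearControl.IsSemiboundedCompactResolvent A 0)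
    (B : X →L[𝕜] X)
    (lam₁ : ℝ) (φ₁ : X) (hφ₁ : BilinearControl.IsFirstEigenpair A lam₁ φ₁)
    (hnull : ∀ T : ℝ, 0 < T → BilinearControl.IsNullControllable A B φ₁ T)
    (ν T₀ : ℝ) (hν : 0 < ν) (hT₀ : 0 < T₀)
    (hcost : ∀ τ : ℝ, 0 < τ → τ ≤ T₀ →
      BilinearControl.controlCost A B φ₁ τ ≤ ENNReal.ofReal (Real.exp (ν / τ))) :
    ∃ r₁ : ℝ, 0 < r₁ ∧ ∀ R : ℝ, 0 < R → ∃ T_R : ℝ, 0 < T_R ∧ ∀ u₀ : X,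
      ‖inner 𝕜 φ₁ u₀ - 1‖ < r₁ → ‖u₀ - inner 𝕜 φ₁ u₀ • φ₁‖ ≤ R →
        BilinearControl.SteersToEigensolution A B lam₁ φ₁ T_R u₀ := by
  have hlam : 0 ≤ lam₁ := hA.nonneg_of_eigenspace_ne_bot fun h => by
    have hmem := hφ₁.mem
    rw [h, Submodule.mem_bot] at hmem
    have h1 := hφ₁.norm_eq_one
    simp [hmem] at h1
  obtain ⟨S, γ, hγ, hS, hSA, hPS, hSfix, hdecay⟩ := hA.exists_contractionSemigroup hφ₁.least
  have hφS : ∀ t, S t φ₁ = φ₁ := fun t => hSfix t φ₁ hφ₁.mem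
  have hT₁ : 0 < min T₀ 1 := lt_min hT₀ one_pos
  have hctrl : ∀ τ, 0 < τ → τ ≤ min T₀ 1 → ∀ v : X, ∃ p : ℝ → 𝕜,
      BilinearControl.IsNullControlWithBound S (B φ₁) τ
        (Real.exp ((ν + lam₁ + 1) / τ) * ‖v‖) v p := fun τ hτ hτ' v =>
    BilinearControl.exists_isNullControlWithBound hSA hlam hτ (hτ'.trans (min_le_right _ _))
      (hcost τ hτ (hτ'.trans (min_le_left _ _))) v
  have hP := BilinearControl.starProjection_eq_inner_smul hS hPS hT₁.le
    (fun v => (hctrl _ hT₁ le_rfl v).imp fun p hp => ⟨_, hp⟩)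
    (Submodule.le_topologicalClosure _ hφ₁.mem) hφ₁.norm_eq_one
  obtain ⟨T, ρ, hT, hρ, hloc⟩ := hS.exists_local_steering hφS (by positivity) hT₁ hctrl
  -- Half of `ρ` is spent on the coefficient along `φ₁`, which does not decay; the other half on the
  -- orthogonal part, which does. Hence `r₁` does not depend on `R`.
  refine ⟨ρ / 2, by positivity, fun R hR => ?_⟩
  -- Chosen so that `R = (ρ/2)γa ≤ (ρ/2)e^{γa}`.
  set a := 2 * R / (ρ * γ) with ha
  have ha0 : 0 < a := by positivity
  refine ⟨a + T, by positivity, fun u₀ hu₀ hu₀' => ?_⟩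
  have hRa : Real.exp (-(γ * a)) * R ≤ ρ / 2 := by
    have h1 : γ * a ≤ Real.exp (γ * a) := by linarith [Real.add_one_le_exp (γ * a)]
    have h2 : R = ρ / 2 * (γ * a) := by
      rw [ha]
      field_simp
    calc Real.exp (-(γ * a)) * R ≤ Real.exp (-(γ * a)) * (ρ / 2 * Real.exp (γ * a)) := by
          gcongr
          rw [h2]
          gcongr
      _ = ρ / 2 := by
          rw [mul_left_comm, ← Real.exp_add, neg_add_cancel, Real.exp_zero, mul_one]
  have hv : ‖S a u₀ - φ₁‖ ≤ ρ := by
    have hsplit : S a u₀ - φ₁ =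
        (inner 𝕜 φ₁ u₀ - 1) • φ₁ + S a (u₀ - inner 𝕜 φ₁ u₀ • φ₁) := by
      rw [map_sub, map_smul, hφS, sub_smul, one_smul]
      abel
    -- Decay requires orthogonality to the whole first eigenspace; `hP` reduces this to
    -- orthogonality to `φ₁`.
    have hd := hdecay a ha0.le (u₀ - inner 𝕜 φ₁ u₀ • φ₁) (by
      rw [← hP, map_sub, BilinearControl.starProjection_starProjection_self, sub_self])
    calc ‖S a u₀ - φ₁‖ ≤ ‖inner 𝕜 φ₁ u₀ - 1‖ * ‖φ₁‖ + Real.exp (-(γ * a)) * R := by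
          rw [hsplit]
          refine (norm_add_le _ _).trans (add_le_add (norm_smul_le _ _) (hd.trans ?_))
          gcongr
      _ ≤ ρ / 2 + ρ / 2 := by
          rw [hφ₁.norm_eq_one, mul_one]
          exact add_le_add hu₀.le hRa
      _ = ρ := by ring
  obtain ⟨p, hp, u, hu, huT⟩ := hloc _ hv
  rw [add_sub_cancel] at hu
  obtain ⟨q, hq, w, hw, hwT⟩ := hS.exists_isBilinearMild_of_free_evolution ha0.le hT.le hp hu
  exact ⟨q, hq, _, hw.isMildSolution hSA, by simp only [hwT, huT]⟩
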